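/- Let $\Gamma$ be a countable (possibly finite) abelian group. A $\Gamma$-subshift is a closed, shift-invariant subset $X$ of $A^\Gamma$ for some finite set $A$, where $\sigma_w(x)_v = x_{v+w}$; a map between $\Gamma$-subshifts is a continuous function commuting with the shift action. Write $\mathrm{stab}(x)=\{v\in\Gamma : \sigma_v(x)=x\}$ and $\mathrm{Ker}(X)=\bigcap_{x\in X}\mathrm{stab}(x)$. Write $X\rightsquigarrow Y$ if for every $x\in X$ there is $y\in Y$ with $\mathrm{stab}(x)\le \mathrm{stab}(y)$. A $\Gamma$-subshift $Y$ has the map extension property if for every $\Gamma$-subshift $X$ (over any finite alphabet) with $X\rightsquigarrow Y$ and every (possibly empty) $\Gamma$-subshift $\tilde X\subseteq X$, every map $\tilde X\to Y$ extends to a map $X\to Y$. For a subgroup $\Gamma_0\le\Gamma$ let $Y_{[\Gamma_0]}=\{y\in Y : \Gamma_0\le \mathrm{stab}(y)\}$, and let $Y_{\Gamma_0}=Y_{[\Gamma_0]}$ if $[\Gamma:\Gamma_0]=\infty$ and $Y_{\Gamma_0}=\{y\in Y : \mathrm{stab}(y)=\Gamma_0\}$ if $[\Gamma:\Gamma_0]<\infty$.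 Let $\overline{Y}_{[\Gamma_0]},\overline{Y}_{\Gamma_0}\subseteq A^{\Gamma/\Gamma_0}$ be the corresponding $(\Gamma/\Gamma_0)$-subshifts, i.e. the sets of $\overline y\in A^{\Gamma/\Gamma_0}$ such that $v\mapsto \overline y_{v+\Gamma_0}$ lies in $Y_{[\Gamma_0]}$, respectively in $Y_{\Gamma_0}$. The entropy of a subshift $X$ over a countable abelian group $G$ is $h(X)=\lim_{n\to\infty}\frac{1}{|F_n|}\log|\{x|_{F_n} : x\in X\}|$ for any Følner sequence $(F_n)$ in $G$, with $h(\emptyset)=-\infty$. The set $\mathrm{Sub}(\Gamma)$ of subgroups of $\Gamma$ carries the Chabauty topology, i.e. the topology induced from the product topology on $\{0,1\}^\Gamma$. **Proposition.** Let $Y$ be a $\Gamma$-subshift with the map extension property. Then $$\lim_{\Gamma_0\to\{0\}} h(\overline{Y}_{[\Gamma_0]}) = h(Y).$$ If furthermore $\mathrm{Ker}(Y)=\{0\}$, then $$\lim_{\Gamma_0\to\{0\}} h(\overline{Y}_{\Gamma_0}) = h(Y).$$ The limits are taken in $[-\infty,\infty)$. In the first limit $\Gamma_0=\{0\}$ is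 allowed. The second limit is over subgroups $\Gamma_0\neq\{0\}$ (so it is vacuous for finite $\Gamma$); if $\Gamma$ is infinite, then $\Gamma_0=\{0\}$ is allowed there as well. -/

import Mathlib

open Filter Topology SymbolicDynamics.FullShift

/-- The Chabauty topology on the set of subgroups of a discrete group `Γ`: the topology induced from
the product topology on `{0,1}^Γ` by sending a subgroup to its indicator function. -/
noncomputable instance chabautyTopology {Γ : Type*} [AddGroup Γ] :
    TopologicalSpace (AddSubgroup Γ) :=
  open Classical in
  TopologicalSpace.induced (fun (H : AddSubgroup Γ) (v : Γ) => decide (v ∈ H)) inferInstance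

section Folner

variable {Γ : Type*} [AddCommGroup Γ]

/-- The `K`-boundary of `F`: all `γ` such that `γ + K` meets both `F` and its complement. -/
def folnerBoundary (K F : Finset Γ) : Set Γ :=
  {γ | (∃ k ∈ K, γ + k ∈ F) ∧ ∃ k ∈ K, γ + k ∉ F}

/-- `F` is `(K, ε)`-invariant if `|∂_K F| < ε |F|`. -/
def IsFolnerInvariant (K : Finset Γ) (ε : ℝ) (F : Finset Γ) : Prop :=
  ((folnerBoundary K F).ncard : ℝ) < ε * (F.card : ℝ)

/-- A Følner sequence: for all finite `K` and all `ε > 0`, eventually `(K, ε)`-invariant. -/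
def IsFolnerSeq (F : ℕ → Finset Γ) : Prop :=
  ∀ (K : Finset Γ) (ε : ℝ), 0 < ε → ∀ᶠ n in atTop, IsFolnerInvariant K ε (F n)

variable (Γ) in
/-- The filter on the finite subsets of `Γ` along which sets become `(K, ε)`-invariant for all
finite `K` and all `ε > 0`. A sequence converges along it if and only if it is a Følner sequence. -/
def folnerFilter : Filter (Finset Γ) :=
  ⨅ (K : Finset Γ) (ε : ℝ) (_ : 0 < ε), 𝓟 {F | IsFolnerInvariant K ε F}

theorem isFolnerSeq_iff_tendsto (F : ℕ → Finset Γ) :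
    IsFolnerSeq F ↔ Tendsto F atTop (folnerFilter Γ) := by
  simp [IsFolnerSeq, folnerFilter, tendsto_iInf, tendsto_principal]

end Folner

section Subshifts

variable {Γ : Type*} [AddCommGroup Γ] {A : Type*}

/-- The set `L_F(X)` of `X`-admissible `F`-patterns: the restrictions to `F` of points of `X`. -/
def admissible (X : Set (Γ → A)) (F : Finset Γ) : Set (F → A) :=
  (fun (x : Γ → A) (v : F) => x v) '' X

open Classical in
/-- The topological entropy `h(X)` of a set `X` of configurations (used for closed invariant `X`
over a finite alphabet): the limit of `log |L_F(X)| / |F|` as `F` runs along any Følner sequence,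
with `h(∅) = -∞`. It is written as the upper limit along the filter that governs all Følner
sequences of the countable abelian group `Γ`. -/
noncomputable def entropy (X : Set (Γ → A)) : EReal :=
  if X = ∅ then ⊥
  else limsup
    (fun F : Finset Γ => ((Real.log ((admissible X F).ncard : ℝ) / (F.card : ℝ) : ℝ) : EReal))
    (folnerFilter Γ)

/-- The stabilizer of a configuration under the shift action. -/
def pointStab (x : Γ → A) : AddSubgroup Γ where
  carrier := {v | shift v x = x}
  zero_mem' := shift_zero x
  add_mem' := by
    intro a b ha hb
    have ha' : shift a x = x := ha
    have hb' : shift b x = x := hb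
    change shift (a + b) x = x
    rw [shift_add, ha', hb']
  neg_mem' := by
    intro a ha
    have ha' : shift a x = x := ha
    change shift (-a) x = x
    have h : shift (a + -a) x = shift (-a) x := by rw [shift_add, ha']
    rw [← h, add_neg_cancel, shift_zero]

variable [TopologicalSpace A]

/-- `Ker(X)`: the subgroup of all `v` whose shift fixes every point of `X`. -/
def subshiftKer (X : Subshift A Γ) : AddSubgroup Γ :=
  ⨅ x ∈ X.carrier, pointStab x

/-- `X_{[Γ₀]}`: the points of `X` whose stabilizer contains `Γ₀`. -/
def fixedPart (X : Subshift A Γ) (Γ₀ : AddSubgroup Γ) : Set (Γ → A) :=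
  {x | x ∈ X.carrier ∧ Γ₀ ≤ pointStab x}

open Classical in
/-- `X_{Γ₀}`: equal to `X_{[Γ₀]}` if `Γ₀` has infinite index, and the set of points of `X` whose
stabilizer is exactly `Γ₀` if `Γ₀` has finite index. -/
noncomputable def exactPart (X : Subshift A Γ) (Γ₀ : AddSubgroup Γ) : Set (Γ → A) :=
  if Γ₀.FiniteIndex then {x | x ∈ X.carrier ∧ pointStab x = Γ₀} else fixedPart X Γ₀

/-- The configurations on `Γ / Γ₀` whose pull-back to `Γ` lies in `S`. -/
def quotientImage (Γ₀ : AddSubgroup Γ) (S : Set (Γ → A)) : Set (Γ ⧸ Γ₀ → A) :=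
  {z | ∃ x ∈ S, ∀ v : Γ, x v = z (v : Γ ⧸ Γ₀)}

variable {B : Type*} [TopologicalSpace B]

/-- A map of subshifts: a continuous function commuting with the shift action. -/
def IsSubshiftMap (X : Subshift B Γ) (Y : Subshift A Γ) (f : X.carrier → Y.carrier) : Prop :=
  Continuous f ∧
    ∀ (v : Γ) (x : X.carrier), (f ⟨shift v x.1, X.mapsTo v x.2⟩ : Γ → A) = shift v (f x).1

/-- `X ⇝ Y`: every stabilizer of a point of `X` is contained in the stabilizer of a point of `Y`. -/
def StabDominated (X : Subshift B Γ) (Y : Subshift A Γ) : Prop :=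
  ∀ x ∈ X.carrier, ∃ y ∈ Y.carrier, pointStab x ≤ pointStab y

/-- The map extension property of `Y`: for all subshifts `X' ⊆ X` (over an arbitrary finite
alphabet, `X'` possibly empty) with `X ⇝ Y`, every map `X' → Y` extends to a map `X → Y`. -/
def HasMapExtensionProperty (Y : Subshift A Γ) : Prop :=
  ∀ (B : Type) [Finite B] [TopologicalSpace B] [DiscreteTopology B]
    (X X' : Subshift B Γ) (hX : X'.carrier ⊆ X.carrier), StabDominated X Y →
    ∀ f' : X'.carrier → Y.carrier, IsSubshiftMap X' Y f' →
      ∃ f : X.carrier → Y.carrier, IsSubshiftMap X Y f ∧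
        ∀ (x : Γ → B) (hx : x ∈ X'.carrier), f ⟨x, hX hx⟩ = f' ⟨x, hx⟩

end Subshifts

/-! A subgroup Γ₀ counts as small when it contains no nonzero element of a prescribed finite set
(`AvoidsNonzero`). Such subgroups form neighbourhoods of the trivial one, and all estimates are
proved for them.

Upper bound. By Shearer's inequality the entropy is the infimum of log|L_F|/|F| over all nonempty
finite F, not only a limit along Følner sets. One nearly optimal F for Y embeds in Γ/Γ₀ when Γ₀ is
small, and quotient patterns on its image are patterns of Y on F. The map extension property plays
no role here.

Lower bound, Γ infinite. The core is `HasMapExtensionProperty.exists_gluing`: for a fixed finite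
window K, every configuration with a small group of periods can be corrected to a point of Y with
these periods, unchanged wherever its K-window is admissible. Let S be a free marker subshift.
Extending the projection Y × S → Y to A^Γ × S gives such a correction as a local rule, but a
Γ₀-periodic input has no free marker. Three facts overcome this. A second use of the extension
property shows that, on free inputs, finitely many marker conditions suffice
(`exists_slidingMap_mem`). Colourings with finitely many marker conditions and periods Γ₀ exist
(`exists_periodic_marker`), by Rosenfeld's counting in Γ/Γ₀. Finally, a periodic input is a limit of
inputs made free by an auxiliary coordinate, and Y is closed. With gluing available, a finite subset
of Γ/Γ₀ is packed by pieces of translates of a K-invariant set F (`exists_packing`). Patterns of Y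
chosen independently on the pieces survive away from the boundaries of the pieces, so almost all of
h(Y) is recovered.

Exact stabilizers. Only finite index n needs an argument. A point with more periods than Γ₀ is fixed
by some Γ₀ + ⟨g⟩ of index at most n/2. If that group is still small, it fixes at most about
exp(h(Y)n/2) points, and there are at most n such groups. Smallness is enforced by writing a fixed
finite pattern that breaks finitely many periods, at negligible cost. The comparison needs h(Y) > 0:
a trivial kernel gives a point with two distinct letters, and gluing places its patterns
independently. -/

/-! ### Shearer's inequality for pattern counts -/

/-- A discrete form of Hölder's inequality for `k` factors. -/
theorem sum_pow_le_mul_prod_sum {ι α : Type*} [Fintype α] (s : Finset ι) (hs : s.Nonempty)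
    (n : α → ℝ) (b : ι → α → ℝ) (C : ℝ) (hC : 0 ≤ C) (hn : ∀ a, 0 ≤ n a) (hb : ∀ i a, 0 ≤ b i a)
    (h : ∀ a, n a ^ s.card ≤ C * ∏ i ∈ s, b i a) :
    (∑ a, n a) ^ s.card ≤ C * ∏ i ∈ s, ∑ a, b i a := by
  have hk : s.card ≠ 0 := by simpa [Finset.card_eq_zero] using hs.ne_empty
  have hk' : (s.card : ℝ) ≠ 0 := by exact_mod_cast hk
  have hB : ∀ i, 0 ≤ ∑ a, b i a := fun i => Finset.sum_nonneg fun a _ => hb i a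
  have hP : 0 ≤ C * ∏ i ∈ s, ∑ a, b i a := mul_nonneg hC (Finset.prod_nonneg fun i _ => hB i)
  by_cases h0 : ∃ i ∈ s, ∑ a, b i a = 0
  · obtain ⟨i, hi, h0⟩ := h0
    have hz : ∀ a, n a = 0 := by
      intro a
      have hba : b i a = 0 :=
        (Finset.sum_eq_zero_iff_of_nonneg fun a _ => hb i a).1 h0 a (Finset.mem_univ a)
      have := h a
      rw [Finset.prod_eq_zero hi hba, mul_zero] at this
      exact eq_zero_of_pow_eq_zero (le_antisymm this (pow_nonneg (hn a) _))
    simpa [hz, hk] using hP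
  · push Not at h0
    have hpos : ∀ i ∈ s, 0 < ∑ a, b i a := fun i hi => lt_of_le_of_ne (hB i) (h0 i hi).symm
    set P := C * ∏ i ∈ s, ∑ a, b i a with hPdef
    set r : ℝ := P ^ ((s.card : ℝ)⁻¹) with hr
    have hr0 : 0 ≤ r := Real.rpow_nonneg hP _
    have hrk : r ^ s.card = P := Real.rpow_inv_natCast_pow hP hk
    -- Weighted AM–GM for the normalised terms; after normalisation each factor sums to 1 over `a`.
    have key : ∀ a, n a ≤ r * ∑ i ∈ s, (s.card : ℝ)⁻¹ * (b i a / ∑ a', b i a') := by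
      intro a
      have hq : ∀ i, 0 ≤ b i a / ∑ a', b i a' := fun i => div_nonneg (hb i a) (hB i)
      have h1 := Real.geom_mean_le_arith_mean_weighted s (fun _ => (s.card : ℝ)⁻¹)
        (fun i => b i a / ∑ a', b i a') (fun _ _ => by positivity)
        (by simp [hk']) (fun i _ => hq i)
      refine le_trans ?_ (mul_le_mul_of_nonneg_left h1 hr0)
      refine le_of_pow_le_pow_left₀ hk
        (mul_nonneg hr0 (Finset.prod_nonneg fun i _ => Real.rpow_nonneg (hq i) _)) ?_
      rw [mul_pow, hrk, ← Finset.prod_pow]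
      simp_rw [Real.rpow_inv_natCast_pow (hq _) hk]
      rw [Finset.prod_div_distrib, hPdef, mul_assoc, mul_div_cancel₀]
      · exact h a
      · exact Finset.prod_ne_zero_iff.2 fun i hi => (hpos i hi).ne'
    have hsum : ∑ a, n a ≤ r := by
      refine (Finset.sum_le_sum fun a _ => key a).trans (le_of_eq ?_)
      rw [← Finset.mul_sum, Finset.sum_comm]
      have : ∀ i ∈ s, ∑ a, (s.card : ℝ)⁻¹ * (b i a / ∑ a', b i a') = (s.card : ℝ)⁻¹ := by
        intro i hi
        rw [← Finset.mul_sum, ← Finset.sum_div, div_self (hpos i hi).ne', mul_one]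
      rw [Finset.sum_congr rfl this]
      simp [hk']
    calc (∑ a, n a) ^ s.card ≤ r ^ s.card :=
          pow_le_pow_left₀ (Finset.sum_nonneg fun a _ => hn a) hsum _
      _ = P := hrk

section Patterns

variable {G A : Type*}

theorem admissible_mono {X X' : Set (G → A)} (h : X ⊆ X')
    (F : Finset G) : admissible X F ⊆ admissible X' F :=
  Set.image_mono h

variable [Finite A]

theorem ncard_admissible_mono {X X' : Set (G → A)} (h : X ⊆ X') (F : Finset G) :
    (admissible X F).ncard ≤ (admissible X' F).ncard :=
  Set.ncard_le_ncard (admissible_mono h F) (Set.toFinite _)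

theorem ncard_admissible_pos {X : Set (G → A)} (h : X.Nonempty) (F : Finset G) :
    0 < (admissible X F).ncard :=
  (Set.ncard_pos (Set.toFinite _)).2 (h.image _)

theorem ncard_admissible_subset {X : Set (G → A)} {F F' : Finset G} (h : F ⊆ F') :
    (admissible X F).ncard ≤ (admissible X F').ncard := by
  have : admissible X F = (fun (p : F' → A) (v : F) => p ⟨v, h v.2⟩) '' admissible X F' := by
    simp [admissible, Set.image_image]
  rw [this]
  exact Set.ncard_image_le (Set.toFinite _)

theorem ncard_admissible_insert [DecidableEq G] [Fintype A] (X : Set (G → A)) {E : Finset G} {e : G}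
    (he : e ∉ E) :
    (admissible X (insert e E)).ncard = ∑ a, (admissible {x ∈ X | x e = a} E).ncard := by
  let Φ : (↥(insert e E) → A) → A × (E → A) := fun p =>
    (p ⟨e, Finset.mem_insert_self e E⟩, fun v => p ⟨v, Finset.mem_insert_of_mem v.2⟩)
  have hΦ : Function.Injective Φ := by
    intro p q hpq
    ext ⟨v, hv⟩
    rcases Finset.mem_insert.1 hv with rfl | hv'
    · exact congrArg Prod.fst hpq
    · exact congrFun (congrArg Prod.snd hpq) ⟨v, hv'⟩
  have himg : Φ '' admissible X (insert e E)
      = ⋃ a, Prod.mk a '' admissible {x ∈ X | x e = a} E := by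
    ext ⟨a, p⟩
    simp only [admissible, Set.image_image, Set.mem_image, Set.mem_iUnion, Set.mem_ofPred_eq, Φ,
      Prod.mk.injEq]
    constructor
    · rintro ⟨x, hx, rfl, rfl⟩
      exact ⟨_, x, ⟨hx, rfl⟩, rfl, rfl⟩
    · rintro ⟨_, x, ⟨hx, rfl⟩, rfl, rfl⟩
      exact ⟨x, hx, rfl, rfl⟩
  rw [← Set.ncard_image_of_injective _ hΦ, himg]
  rw [Set.ncard_iUnion_of_finite (fun a => Set.toFinite _), finsum_eq_sum_of_fintype]
  · refine Finset.sum_congr rfl fun a _ => ?_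
    exact Set.ncard_image_of_injective _ (Prod.mk_right_injective a)
  · intro a a' haa
    refine Set.disjoint_left.2 ?_
    rintro _ ⟨p, -, rfl⟩ ⟨q, -, hq⟩
    exact haa (congrArg Prod.fst hq).symm

/-- **Shearer's inequality** for the numbers of admissible patterns: if the sets `S j ⊆ E` cover
each point of `E` exactly `k` times, then `|L_E|^k ≤ ∏ |L_{S j}|`. -/
theorem ncard_admissible_pow_le_prod [DecidableEq G] {ι : Type*} (J : Finset ι) {k : ℕ} (hk : k ≠ 0)
    (E : Finset G) : ∀ (X : Set (G → A)) (S : ι → Finset G), (∀ j ∈ J, S j ⊆ E) →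
      (∀ e ∈ E, (J.filter fun j => e ∈ S j).card = k) →
      ((admissible X E).ncard : ℝ) ^ k ≤ ∏ j ∈ J, ((admissible X (S j)).ncard : ℝ) := by
  have := Fintype.ofFinite A
  induction E using Finset.induction_on with
  | empty =>
    intro X S hS _
    have hS' : ∀ j ∈ J, S j = ∅ := fun j hj => Finset.subset_empty.1 (hS j hj)
    rw [Finset.prod_congr rfl fun j hj => by rw [hS' j hj]]
    rcases X.eq_empty_or_nonempty with rfl | hX
    · simp only [admissible, Set.image_empty, Set.ncard_empty]
      rw [Nat.cast_zero, zero_pow hk]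
      positivity
    · have h1 : (admissible X (∅ : Finset G)).ncard = 1 := by
        obtain ⟨x, hx⟩ := hX
        refine Set.ncard_eq_one.2 ⟨fun v => x v, ?_⟩
        ext p
        exact ⟨fun _ => Subsingleton.elim _ _, fun h => ⟨x, hx, h.symm⟩⟩
      simp [h1]
  | insert e E he ih =>
    intro X S hS hcov
    -- Condition on the letter at `e`: counts on windows containing `e` split into sums over that
    -- letter, while the other counts can only shrink. The induction hypothesis for each letter is
    -- then combined by the Hölder-type inequality.
    set s := J.filter fun j => e ∈ S j with hs
    have hsk : s.card = k := hcov e (Finset.mem_insert_self e E)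
    have hsne : s.Nonempty := by
      rw [← Finset.card_pos, hsk]; exact Nat.pos_of_ne_zero hk
    have herase : ∀ j, e ∈ S j → S j = insert e ((S j).erase e) := fun j hj =>
      (Finset.insert_erase hj).symm
    rw [← Finset.prod_filter_mul_prod_filter_not J (fun j => e ∈ S j), mul_comm,
      ncard_admissible_insert X he]
    have hB : ∀ j ∈ s, ((admissible X (S j)).ncard : ℝ)
        = ∑ a, ((admissible {x ∈ X | x e = a} ((S j).erase e)).ncard : ℝ) := by
      intro j hj
      conv_lhs => rw [herase j (Finset.mem_filter.1 hj).2]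
      rw [ncard_admissible_insert X (Finset.notMem_erase _ _)]
      push_cast
      rfl
    rw [Finset.prod_congr rfl hB]
    push_cast
    rw [← hsk]
    refine sum_pow_le_mul_prod_sum s hsne _ _ _ (by positivity) (fun a => by positivity)
      (fun i a => by positivity) fun a => ?_
    rw [hsk]
    refine (ih {x ∈ X | x e = a} (fun j => (S j).erase e) ?_ ?_).trans ?_
    · intro j hj v hv
      obtain ⟨hv1, hv2⟩ := Finset.mem_erase.1 hv
      exact (Finset.mem_insert.1 (hS j hj hv2)).resolve_left hv1
    · intro v hv
      have hve : v ≠ e := fun h => he (h ▸ hv)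
      simpa [hve] using hcov v (Finset.mem_insert_of_mem hv)
    · rw [← Finset.prod_filter_mul_prod_filter_not J (fun j => e ∈ S j), mul_comm]
      refine mul_le_mul_of_nonneg_right ?_ (by positivity)
      refine Finset.prod_le_prod (fun _ _ => by positivity) fun j hj => ?_
      have hj' : e ∉ S j := (Finset.mem_filter.1 hj).2
      rw [Finset.erase_eq_of_notMem hj']
      exact_mod_cast ncard_admissible_mono (Set.sep_subset _ _) _

variable [AddCommGroup G]

/-- The number of admissible patterns is invariant under translation of the window. -/
theorem ncard_admissible_image_add [DecidableEq G] {X : Set (G → A)}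
    (hX : ∀ v, Set.MapsTo (shift v) X X) (F : Finset G) (g : G) :
    (admissible X (F.image (g + ·))).ncard ≤ (admissible X F).ncard := by
  have hmem : ∀ v : (F.image (g + ·) : Finset G), -g + (v : G) ∈ F := by
    rintro ⟨v, hv⟩
    obtain ⟨w, hw, rfl⟩ := Finset.mem_image.1 hv
    simpa using hw
  have hsub : admissible X (F.image (g + ·))
      ⊆ (fun (p : F → A) (v : (F.image (g + ·) : Finset G)) => p ⟨-g + v, hmem v⟩) ''
        admissible X F := by
    rintro _ ⟨x, hx, rfl⟩
    refine ⟨fun v => x (g + v), ⟨shift g x, hX g hx, rfl⟩, ?_⟩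
    ext v
    simp
  exact (Set.ncard_le_ncard hsub (Set.toFinite _)).trans (Set.ncard_image_le (Set.toFinite _))

open Pointwise in
/-- Pattern counts on `E` are controlled by the pattern count on `F`, one factor for each translate
of `F` that meets `E`. -/
theorem card_mul_log_ncard_admissible_le [DecidableEq G] {X : Set (G → A)} (hXne : X.Nonempty)
    (hX : ∀ v, Set.MapsTo (shift v) X X) (F E : Finset G) (hF : F.Nonempty) :
    F.card * Real.log (admissible X E).ncard
      ≤ (E - F).card * Real.log (admissible X F).ncard := by
  have h := ncard_admissible_pow_le_prod (E - F) (Finset.card_ne_zero.2 hF) E X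
    (fun g => F.image (g + ·) ∩ E) (fun _ _ => Finset.inter_subset_right) (by
      intro e he
      -- A point `e` lies in g + F exactly for g in e - F, hence in |F| of the translates.
      have : ((E - F).filter fun g => e ∈ F.image (g + ·) ∩ E) = F.image (e - ·) := by
        ext g
        simp only [Finset.mem_filter, Finset.mem_inter, Finset.mem_image, he, and_true,
          Finset.mem_sub]
        constructor
        · rintro ⟨-, f, hf, rfl⟩
          exact ⟨f, hf, by abel⟩
        · rintro ⟨f, hf, rfl⟩
          exact ⟨⟨e, he, f, hf, rfl⟩, f, hf, by abel⟩
      rw [this, Finset.card_image_of_injective _ sub_right_injective])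
  have h1 : (0 : ℝ) < (admissible X E).ncard := by exact_mod_cast ncard_admissible_pos hXne E
  have h2 : (0 : ℝ) < (admissible X F).ncard := by exact_mod_cast ncard_admissible_pos hXne F
  have h3 : ∏ g ∈ E - F, ((admissible X (F.image (g + ·) ∩ E)).ncard : ℝ)
      ≤ ((admissible X F).ncard : ℝ) ^ (E - F).card := by
    rw [← Finset.prod_const]
    refine Finset.prod_le_prod (fun _ _ => by positivity) fun g _ => ?_
    exact_mod_cast (ncard_admissible_subset Finset.inter_subset_left).trans
      (ncard_admissible_image_add hX F g)
  have := Real.log_le_log (by positivity) (h.trans h3)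
  rwa [Real.log_pow, Real.log_pow] at this

end Patterns

/-! ### The Følner filter of an abelian group -/

section FolnerFilter

variable {G : Type*} [AddCommGroup G]

open Pointwise in
theorem folnerBoundary_subset_sub [DecidableEq G] (K F : Finset G) :
    folnerBoundary K F ⊆ ((F - K : Finset G) : Set G) := by
  rintro g ⟨⟨k, hk, hkF⟩, -⟩
  exact Finset.mem_coe.2 (Finset.mem_sub.2 ⟨g + k, hkF, k, hk, by abel⟩)

theorem finite_folnerBoundary (K F : Finset G) : (folnerBoundary K F).Finite := by
  classical
  exact (Finset.finite_toSet _).subset (folnerBoundary_subset_sub K F)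

theorem folnerBoundary_mono {K K' : Finset G} (h : K ⊆ K') (F : Finset G) :
    folnerBoundary K F ⊆ folnerBoundary K' F :=
  fun _ ⟨⟨k, hk, hkF⟩, k', hk', hkF'⟩ => ⟨⟨k, h hk, hkF⟩, k', h hk', hkF'⟩

theorem IsFolnerInvariant.mono {K K' F : Finset G} {ε ε' : ℝ} (h : IsFolnerInvariant K' ε' F)
    (hK : K ⊆ K') (hε : ε' ≤ ε) : IsFolnerInvariant K ε F := by
  unfold IsFolnerInvariant at *
  have h1 : ((folnerBoundary K F).ncard : ℝ) ≤ (folnerBoundary K' F).ncard := by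
    exact_mod_cast Set.ncard_le_ncard (folnerBoundary_mono hK F) (finite_folnerBoundary K' F)
  have h2 : ε' * (F.card : ℝ) ≤ ε * F.card := mul_le_mul_of_nonneg_right hε (Nat.cast_nonneg _)
  linarith

theorem IsFolnerInvariant.nonempty {K F : Finset G} {ε : ℝ} (h : IsFolnerInvariant K ε F) :
    F.Nonempty := by
  rw [Finset.nonempty_iff_ne_empty]
  rintro rfl
  simp only [IsFolnerInvariant, Finset.card_empty, Nat.cast_zero, mul_zero] at h
  exact absurd h (not_lt.2 (Nat.cast_nonneg _))

open Pointwise in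
/-- The iterated sumsets of a finite subset of an abelian group grow polynomially. -/
theorem card_nsmul_finset_le [DecidableEq G] (K : Finset G) (N : ℕ) :
    (N • K).card ≤ (N + 1) ^ K.card := by
  have hrep : ∀ N : ℕ, ∀ x ∈ N • K, ∃ c : K → ℕ, (∀ k, c k ≤ N) ∧ x = ∑ k, c k • (k : G) := by
    intro N
    induction N with
    | zero =>
      intro x hx
      refine ⟨0, fun k => le_rfl, ?_⟩
      rw [zero_nsmul, Finset.mem_zero] at hx
      simp [hx]
    | succ N ih =>
      intro x hx
      rw [succ_nsmul] at hx
      obtain ⟨y, hy, k, hk, rfl⟩ := Finset.mem_add.1 hx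
      obtain ⟨c, hc, rfl⟩ := ih y hy
      refine ⟨c + Pi.single ⟨k, hk⟩ 1, fun k' => ?_, ?_⟩
      · refine add_le_add (hc k') ?_
        by_cases h : k' = ⟨k, hk⟩
        · subst h; simp
        · simp [Pi.single_eq_of_ne h]
      · simp only [Pi.add_apply, add_smul, Finset.sum_add_distrib]
        congr 1
        rw [Finset.sum_eq_single (⟨k, hk⟩ : K)]
        · simp
        · intro b _ hb
          simp [Pi.single_eq_of_ne hb]
        · simp
  have hsub : N • K ⊆ (Fintype.piFinset fun _ : K => Finset.range (N + 1)).image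
      (fun c => ∑ k : K, c k • (k : G)) := by
    intro x hx
    obtain ⟨c, hc, rfl⟩ := hrep N x hx
    exact Finset.mem_image.2 ⟨c, by simpa [Nat.lt_succ_iff] using hc, rfl⟩
  refine (Finset.card_le_card hsub).trans (Finset.card_image_le.trans ?_)
  simp [Fintype.card_piFinset]

-- Abelian groups are amenable because sumsets grow polynomially: the ratio |(n+2)K'|/|nK'| cannot
-- always be at least 1 + ε. When it is smaller, (n+1)K' is invariant, since its K-boundary lies in
-- (n+2)K' \ nK'.
open Pointwise in
theorem exists_isFolnerInvariant (K : Finset G) {ε : ℝ} (hε : 0 < ε) :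
    ∃ F : Finset G, IsFolnerInvariant K ε F := by
  classical
  set K' : Finset G := insert 0 (K ∪ -K) with hK'
  have h0 : (0 : G) ∈ K' := Finset.mem_insert_self _ _
  have hmono : ∀ n : ℕ, n • K' ⊆ (n + 1) • K' := by
    intro n x hx
    rw [succ_nsmul]
    exact Finset.mem_add.2 ⟨x, hx, 0, h0, add_zero x⟩
  obtain ⟨n, hn⟩ : ∃ n : ℕ, ((((n + 2) • K').card : ℝ)) < (1 + ε) * (n • K').card := by
    by_contra! hcon
    have hexp : ∀ m : ℕ, (1 + ε) ^ m ≤ (((2 * m) • K').card : ℝ) := by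
      intro m
      induction m with
      | zero => simp
      | succ m ih =>
        rw [pow_succ, mul_comm]
        exact (mul_le_mul_of_nonneg_left ih (by positivity)).trans (hcon (2 * m))
    have hlim := tendsto_pow_const_div_const_pow_of_one_lt K'.card
      (show (1 : ℝ) < 1 + ε by linarith)
    have h3 : (0 : ℝ) < ((3 : ℝ) ^ K'.card)⁻¹ := by positivity
    obtain ⟨m, hm, hm1⟩ := ((hlim.eventually (gt_mem_nhds h3)).and (eventually_ge_atTop 1)).exists
    have hm1' : (1 : ℝ) ≤ m := by exact_mod_cast hm1
    rw [div_lt_iff₀ (by positivity), inv_mul_eq_div, lt_div_iff₀ (by positivity)] at hm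
    have h4 : (((2 * m) • K').card : ℝ) ≤ (2 * (m : ℝ) + 1) ^ K'.card := by
      exact_mod_cast card_nsmul_finset_le K' (2 * m)
    have h5 : (2 * (m : ℝ) + 1) ^ K'.card ≤ (m : ℝ) ^ K'.card * 3 ^ K'.card := by
      rw [← mul_pow]
      exact pow_le_pow_left₀ (by positivity) (by linarith) _
    linarith [hexp m]
  refine ⟨(n + 1) • K', ?_⟩
  have hbd : folnerBoundary K ((n + 1) • K') ⊆ (((n + 2) • K' \ n • K' : Finset G) : Set G) := by
    rintro g ⟨⟨k, hk, hkF⟩, k', hk', hkF'⟩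
    refine Finset.mem_coe.2 (Finset.mem_sdiff.2 ⟨?_, fun hg => hkF' ?_⟩)
    · rw [show n + 2 = (n + 1) + 1 from rfl, succ_nsmul _ (n + 1)]
      refine Finset.mem_add.2 ⟨g + k, hkF, -k, ?_, by abel⟩
      simp [hK', hk]
    · rw [succ_nsmul]
      exact Finset.mem_add.2 ⟨g, hg, k', by simp [hK', hk'], rfl⟩
  have hsub : n • K' ⊆ (n + 2) • K' := (hmono n).trans (hmono (n + 1))
  have h1 := Set.ncard_le_ncard hbd (Finset.finite_toSet _)
  rw [Set.ncard_coe_finset, Finset.card_sdiff_of_subset hsub] at h1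
  have h2 := Finset.card_le_card hsub
  have h3 : ((folnerBoundary K ((n + 1) • K')).ncard : ℝ)
      ≤ ((n + 2) • K').card - (n • K').card := by
    rw [← Nat.cast_sub h2]; exact_mod_cast h1
  have h4 : ((n • K').card : ℝ) ≤ ((n + 1) • K').card := by
    exact_mod_cast Finset.card_le_card (hmono n)
  have h5 := mul_le_mul_of_nonneg_left h4 hε.le
  unfold IsFolnerInvariant
  linarith

theorem eventually_isFolnerInvariant (K : Finset G) {ε : ℝ} (hε : 0 < ε) :
    ∀ᶠ F in folnerFilter G, IsFolnerInvariant K ε F :=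
  mem_iInf_of_mem K (mem_iInf_of_mem ε (mem_iInf_of_mem hε (mem_principal_self _)))

theorem eventually_folnerFilter_nonempty : ∀ᶠ F in folnerFilter G, F.Nonempty :=
  (eventually_isFolnerInvariant ∅ one_pos).mono fun _ h => h.nonempty

instance neBot_folnerFilter : (folnerFilter G).NeBot := by
  classical
  have : folnerFilter G
      = ⨅ i : Finset G × {ε : ℝ // 0 < ε}, 𝓟 {F | IsFolnerInvariant i.1 i.2 F} := by
    simp only [folnerFilter, iInf_prod, iInf_subtype]
  rw [this]
  have : Nonempty (Finset G × {ε : ℝ // 0 < ε}) := ⟨(∅, ⟨1, one_pos⟩)⟩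
  refine iInf_neBot_of_directed' ?_ ?_
  · rintro ⟨K, ε, hε⟩ ⟨K', ε', hε'⟩
    refine ⟨(K ∪ K', ⟨min ε ε', lt_min hε hε'⟩), ?_, ?_⟩
    · exact principal_mono.2 fun F hF =>
        IsFolnerInvariant.mono hF Finset.subset_union_left (min_le_left _ _)
    · exact principal_mono.2 fun F hF =>
        IsFolnerInvariant.mono hF Finset.subset_union_right (min_le_right _ _)
  · rintro ⟨K, ε, hε⟩
    exact principal_neBot_iff.2 (exists_isFolnerInvariant K hε)

-- Fix f in F: a translate of F meeting E either sends f into E, which leaves |E| possibilities, or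
-- meets both E and its complement.
open Pointwise in
theorem card_sub_le [DecidableEq G] (E F : Finset G) (hF : F.Nonempty) :
    (E - F).card ≤ E.card + (folnerBoundary F E).ncard := by
  obtain ⟨f, hf⟩ := hF
  have hsub : ((E - F : Finset G) : Set G) ⊆ (E.image (· - f) : Finset G) ∪ folnerBoundary F E := by
    intro g hg
    obtain ⟨e, he, f', hf', rfl⟩ := Finset.mem_sub.1 (Finset.mem_coe.1 hg)
    by_cases h : e - f' + f ∈ E
    · exact Or.inl (Finset.mem_coe.2 (Finset.mem_image.2 ⟨_, h, by abel⟩))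
    · exact Or.inr ⟨⟨f', hf', by simpa using he⟩, f, hf, h⟩
  have h1 := Set.ncard_le_ncard hsub
    ((Finset.finite_toSet _).union (finite_folnerBoundary F E))
  rw [Set.ncard_coe_finset] at h1
  refine h1.trans ((Set.ncard_union_le _ _).trans (add_le_add_left ?_ _))
  rw [Set.ncard_coe_finset]
  exact Finset.card_image_le

/-- In a finite group the only sufficiently invariant finite set is the whole group. -/
theorem eventually_folnerFilter_eq_univ [Fintype G] :
    ∀ᶠ F in folnerFilter G, F = Finset.univ := by
  filter_upwards [eventually_isFolnerInvariant (Finset.univ : Finset G) one_pos] with F hF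
  obtain ⟨f, hf⟩ := hF.nonempty
  by_contra hne
  obtain ⟨f', hf'⟩ : ∃ f', f' ∉ F := by
    by_contra! h
    exact hne (Finset.eq_univ_iff_forall.2 h)
  have hall : folnerBoundary Finset.univ F = Set.univ := by
    refine Set.eq_univ_of_forall fun g => ⟨⟨f - g, Finset.mem_univ _, ?_⟩, f' - g,
      Finset.mem_univ _, ?_⟩ <;> simpa
  have : (F.card : ℝ) ≤ Fintype.card G := by exact_mod_cast Finset.card_le_univ F
  unfold IsFolnerInvariant at hF
  rw [hall, Set.ncard_univ, Nat.card_eq_fintype_card] at hF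
  linarith

end FolnerFilter

/-! ### Entropy as an infimum -/

section Entropy

variable {G A : Type*} [AddCommGroup G]

theorem entropy_eq_limsup {X : Set (G → A)} (hX : X.Nonempty) :
    entropy X = limsup
      (fun F : Finset G => ((Real.log ((admissible X F).ncard : ℝ) / (F.card : ℝ) : ℝ) : EReal))
      (folnerFilter G) := by
  rw [entropy, if_neg hX.ne_empty]

theorem entropy_empty : entropy (∅ : Set (G → A)) = ⊥ := by simp [entropy]

theorem le_entropy {X : Set (G → A)} (hX : X.Nonempty) {c : ℝ}
    (h : ∀ᶠ F in folnerFilter G, c ≤ Real.log ((admissible X F).ncard : ℝ) / (F.card : ℝ)) :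
    (c : EReal) ≤ entropy X := by
  rw [entropy_eq_limsup hX]
  refine le_limsup_of_frequently_le (Eventually.frequently ?_)
  exact h.mono fun F hF => EReal.coe_le_coe_iff.2 hF

theorem exists_log_ncard_admissible_lt {X : Set (G → A)} (hXne : X.Nonempty) {c : ℝ}
    (hc : entropy X < c) :
    ∃ F : Finset G, F.Nonempty ∧ Real.log ((admissible X F).ncard : ℝ) < c * F.card := by
  rw [entropy_eq_limsup hXne] at hc
  obtain ⟨F, hF, hFne⟩ := ((eventually_lt_of_limsup_lt hc).and
    eventually_folnerFilter_nonempty).exists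
  refine ⟨F, hFne, ?_⟩
  rwa [EReal.coe_lt_coe_iff, div_lt_iff₀ (by exact_mod_cast hFne.card_pos)] at hF

variable [Finite A]

theorem entropy_mono {X X' : Set (G → A)} (h : X ⊆ X') : entropy X ≤ entropy X' := by
  rcases X.eq_empty_or_nonempty with rfl | hX
  · simp [entropy_empty]
  rw [entropy_eq_limsup hX, entropy_eq_limsup (hX.mono h)]
  refine limsup_le_limsup (Eventually.of_forall fun F => EReal.coe_le_coe_iff.2 ?_)
  have h1 : (0 : ℝ) < (admissible X F).ncard := by exact_mod_cast ncard_admissible_pos hX F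
  gcongr
  exact Set.toFinite _
  exact admissible_mono h F

-- Shearer's inequality gives |F| log|L_E| ≤ |E - F| log|L_F|, and |E - F| is at most (1 + ε)|E| for
-- invariant E. So any single window, Følner or not, bounds the entropy from above.
open Pointwise in
theorem entropy_le_log_ncard_admissible {X : Set (G → A)}
    (hX : ∀ v, Set.MapsTo (shift v) X X) {F : Finset G} (hF : F.Nonempty) :
    entropy X ≤ ((Real.log ((admissible X F).ncard : ℝ) / (F.card : ℝ) : ℝ) : EReal) := by
  classical
  rcases X.eq_empty_or_nonempty with rfl | hXne
  · simp [entropy_empty]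
  set L := Real.log ((admissible X F).ncard : ℝ) with hL
  have hL0 : 0 ≤ L := Real.log_nonneg (by exact_mod_cast ncard_admissible_pos hXne F)
  have hFc : (0 : ℝ) < F.card := by exact_mod_cast hF.card_pos
  have key : ∀ ε : ℝ, 0 < ε → entropy X ≤ (((1 + ε) * (L / F.card) : ℝ) : EReal) := by
    intro ε hε
    rw [entropy_eq_limsup hXne]
    refine limsup_le_of_le (h := ?_)
    filter_upwards [eventually_isFolnerInvariant F hε] with E hE
    refine EReal.coe_le_coe_iff.2 ?_
    have hEc : (0 : ℝ) < E.card := by exact_mod_cast hE.nonempty.card_pos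
    have h1 := card_mul_log_ncard_admissible_le hXne hX F E hF
    have h2 : ((Finset.card (E - F) : ℕ) : ℝ) ≤ E.card + (folnerBoundary F E).ncard := by
      exact_mod_cast card_sub_le E F hF
    have h3 : ((Finset.card (E - F) : ℕ) : ℝ) ≤ (1 + ε) * E.card := by
      unfold IsFolnerInvariant at hE; linarith
    have h4 := mul_le_mul_of_nonneg_right h3 hL0
    rw [div_le_iff₀ hEc, mul_assoc, div_mul_eq_mul_div, ← mul_div_assoc, le_div_iff₀ hFc]
    linarith
  have hlim : Tendsto (fun ε : ℝ => (((1 + ε) * (L / F.card) : ℝ) : EReal)) (𝓝[>] 0)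
      (𝓝 ((L / F.card : ℝ) : EReal)) := by
    have : Tendsto (fun ε : ℝ => (1 + ε) * (L / F.card)) (𝓝 0) (𝓝 ((1 + 0) * (L / F.card))) :=
      (continuous_const.add continuous_id).mul continuous_const |>.tendsto 0
    rw [add_zero, one_mul] at this
    exact (continuous_coe_real_ereal.tendsto _).comp (this.mono_left nhdsWithin_le_nhds)
  exact ge_of_tendsto hlim (eventually_nhdsWithin_of_forall fun ε hε => key ε hε)

/-- The entropy of a nonempty invariant set is a nonnegative real number that bounds all normalized
logarithmic pattern counts from below. -/
theorem exists_entropy_eq {X : Set (G → A)} (hXne : X.Nonempty)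
    (hX : ∀ v, Set.MapsTo (shift v) X X) :
    ∃ h : ℝ, 0 ≤ h ∧ entropy X = h ∧
      ∀ F : Finset G, h * F.card ≤ Real.log ((admissible X F).ncard : ℝ) := by
  have h0 : (0 : EReal) ≤ entropy X := by
    refine le_entropy hXne (c := 0) (Eventually.of_forall fun F => ?_)
    exact div_nonneg (Real.log_nonneg (by exact_mod_cast ncard_admissible_pos hXne F))
      (Nat.cast_nonneg _)
  have h1 := entropy_le_log_ncard_admissible hX (Finset.singleton_nonempty (0 : G))
  lift entropy X to ℝ using ⟨ne_top_of_le_ne_top (EReal.coe_ne_top _) h1,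
    ne_bot_of_le_ne_bot EReal.zero_ne_bot h0⟩ with h hh
  refine ⟨h, by exact_mod_cast h0, rfl, fun F => ?_⟩
  rcases F.eq_empty_or_nonempty with rfl | hF
  · simpa using Real.log_nonneg (by exact_mod_cast ncard_admissible_pos hXne ∅)
  · have h2 := entropy_le_log_ncard_admissible hX hF
    rw [← hh, EReal.coe_le_coe_iff, le_div_iff₀ (by exact_mod_cast hF.card_pos)] at h2
    exact h2

end Entropy

/-! ### Small subgroups in the Chabauty topology -/

section Chabauty

variable {Γ : Type*} [AddCommGroup Γ]

/-- `Γ₀` contains no nonzero element of the finite set `V`. -/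
def AvoidsNonzero (Γ₀ : AddSubgroup Γ) (V : Finset Γ) : Prop :=
  ∀ v ∈ V, v ∈ Γ₀ → v = 0

theorem AvoidsNonzero.mono {Γ₀ : AddSubgroup Γ} {V V' : Finset Γ} (h : AvoidsNonzero Γ₀ V')
    (hV : V ⊆ V') : AvoidsNonzero Γ₀ V :=
  fun v hv => h v (hV hv)

theorem avoidsNonzero_bot (V : Finset Γ) : AvoidsNonzero (⊥ : AddSubgroup Γ) V :=
  fun _ _ hv => AddSubgroup.mem_bot.1 hv

/-- This is the only feature of the Chabauty topology that the proof needs. -/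
theorem eventually_avoidsNonzero (V : Finset Γ) :
    ∀ᶠ Γ₀ in 𝓝 (⊥ : AddSubgroup Γ), AvoidsNonzero Γ₀ V := by
  classical
  rw [nhds_induced, eventually_comap]
  have hopen : IsOpen {c : Γ → Bool | ∀ v ∈ V, v ≠ 0 → c v = false} := by
    have : {c : Γ → Bool | ∀ v ∈ V, v ≠ 0 → c v = false}
        = ⋂ v ∈ V, {c : Γ → Bool | v ≠ 0 → c v = false} := by ext; simp
    rw [this]
    refine isOpen_biInter_finset fun v _ => ?_
    by_cases hv : v = 0
    · simp [hv]
    · have := (isOpen_discrete ({false} : Set Bool)).preimage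
        (continuous_apply (A := fun _ : Γ => Bool) v)
      simpa [hv, Set.preimage] using this
  refine (hopen.eventually_mem ?_).mono ?_
  · intro v _ hv
    simpa using hv
  · rintro c hc Γ₀ rfl v hv hvΓ
    by_contra hne
    simpa [hvΓ] using hc v hv hne

open Pointwise in
theorem AvoidsNonzero.injOn_mk [DecidableEq Γ] {Γ₀ : AddSubgroup Γ} {F : Finset Γ}
    (h : AvoidsNonzero Γ₀ (F - F)) : Set.InjOn (QuotientAddGroup.mk : Γ → Γ ⧸ Γ₀) F := by
  intro a ha b hb hab
  have h1 : -a + b ∈ Γ₀ := QuotientAddGroup.eq.1 hab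
  have h2 := h (b - a) (Finset.sub_mem_sub hb ha) (by rwa [sub_eq_neg_add])
  exact (sub_eq_zero.1 h2).symm

end Chabauty

/-! ### Periodic configurations and quotients -/

section Quotient

variable {Γ A : Type*} [AddCommGroup Γ]

theorem mem_pointStab {x : Γ → A} {v : Γ} : v ∈ pointStab x ↔ ∀ u, x (v + u) = x u :=
  ⟨fun h u => congrFun (show shift v x = x from h) u, fun h => funext h⟩

theorem le_pointStab_iff_exists {Γ₀ : AddSubgroup Γ} {x : Γ → A} :
    Γ₀ ≤ pointStab x ↔ ∃ z : Γ ⧸ Γ₀ → A, ∀ v : Γ, x v = z v := by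
  constructor
  · intro h
    refine ⟨Quotient.lift x fun a b hab => ?_, fun v => rfl⟩
    have h1 : -a + b ∈ Γ₀ := QuotientAddGroup.leftRel_apply.1 hab
    have := mem_pointStab.1 (h h1) a
    rw [← this]
    congr 1
    abel
  · rintro ⟨z, hz⟩ v hv
    refine mem_pointStab.2 fun u => ?_
    rw [hz, hz, QuotientAddGroup.mk_add, (QuotientAddGroup.eq_zero_iff v).2 hv, zero_add]

theorem mem_quotientImage {Γ₀ : AddSubgroup Γ} {S : Set (Γ → A)} {z : Γ ⧸ Γ₀ → A} :
    z ∈ quotientImage Γ₀ S ↔ (fun v : Γ => z v) ∈ S := by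
  constructor
  · rintro ⟨x, hx, hxz⟩
    rwa [show (fun v : Γ => z v) = x from funext fun v => (hxz v).symm]
  · exact fun h => ⟨_, h, fun _ => rfl⟩

theorem quotientImage_mono (Γ₀ : AddSubgroup Γ) {S S' : Set (Γ → A)} (h : S ⊆ S') :
    quotientImage Γ₀ S ⊆ quotientImage Γ₀ S' :=
  fun _ ⟨x, hx, hxz⟩ => ⟨x, h hx, hxz⟩

theorem mapsTo_shift_quotientImage (Γ₀ : AddSubgroup Γ) {S : Set (Γ → A)}
    (hS : ∀ v, Set.MapsTo (shift v) S S) (g : Γ ⧸ Γ₀) :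
    Set.MapsTo (shift g) (quotientImage Γ₀ S) (quotientImage Γ₀ S) := by
  rintro z ⟨x, hx, hxz⟩
  induction g using QuotientAddGroup.induction_on with
  | H v => exact ⟨shift v x, hS v hx, fun u => by simp [hxz]⟩

theorem pointStab_shift (v : Γ) (x : Γ → A) : pointStab (shift v x) = pointStab x := by
  ext u
  simp only [mem_pointStab, shift_apply]
  constructor
  · intro h w
    have := h (w - v)
    rwa [add_sub_cancel, add_left_comm, add_sub_cancel] at this
  · intro h w
    rw [add_left_comm, h]

theorem ncard_admissible_quotientImage_le [Finite A] [DecidableEq Γ] (Γ₀ : AddSubgroup Γ)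
    [DecidableEq (Γ ⧸ Γ₀)] (S : Set (Γ → A)) (F : Finset Γ) :
    (admissible (quotientImage Γ₀ S) (F.image (QuotientAddGroup.mk : Γ → Γ ⧸ Γ₀))).ncard
      ≤ (admissible S F).ncard := by
  refine Set.ncard_le_ncard_of_injOn
    (fun p (v : F) => p ⟨(v : Γ), Finset.mem_image_of_mem _ v.2⟩) ?_ ?_ (Set.toFinite _)
  · rintro _ ⟨z, ⟨x, hx, hxz⟩, rfl⟩
    exact ⟨x, hx, funext fun v => hxz v⟩
  · intro p _ q _ hpq
    ext ⟨g, hg⟩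
    obtain ⟨v, hv, rfl⟩ := Finset.mem_image.1 hg
    exact congrFun hpq ⟨v, hv⟩

variable [TopologicalSpace A]

theorem mapsTo_shift_fixedPart (Y : Subshift A Γ) (Γ₀ : AddSubgroup Γ) (v : Γ) :
    Set.MapsTo (shift v) (fixedPart Y Γ₀) (fixedPart Y Γ₀) :=
  fun _ ⟨hx, hst⟩ => ⟨Y.mapsTo v hx, hst.trans (pointStab_shift v _).ge⟩

theorem exactPart_subset_fixedPart (Y : Subshift A Γ) (Γ₀ : AddSubgroup Γ) :
    exactPart Y Γ₀ ⊆ fixedPart Y Γ₀ := by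
  unfold exactPart
  split_ifs
  · exact fun x hx => ⟨hx.1, hx.2.ge⟩
  · exact subset_rfl

open Pointwise in
theorem entropy_quotientImage_fixedPart_le [Finite A] [DecidableEq Γ] (Y : Subshift A Γ)
    {Γ₀ : AddSubgroup Γ} {F : Finset Γ} (hF : F.Nonempty) (hΓ : AvoidsNonzero Γ₀ (F - F)) :
    entropy (quotientImage Γ₀ (fixedPart Y Γ₀))
      ≤ ((Real.log ((admissible Y.carrier F).ncard : ℝ) / (F.card : ℝ) : ℝ) : EReal) := by
  classical
  rcases (quotientImage Γ₀ (fixedPart Y Γ₀)).eq_empty_or_nonempty with h | hne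
  · simp [h, entropy_empty]
  refine (entropy_le_log_ncard_admissible
    (mapsTo_shift_quotientImage Γ₀ (mapsTo_shift_fixedPart Y Γ₀))
    (hF.image (QuotientAddGroup.mk : Γ → Γ ⧸ Γ₀))).trans ?_
  rw [Finset.card_image_of_injOn hΓ.injOn_mk]
  refine EReal.coe_le_coe_iff.2 (div_le_div_of_nonneg_right (Real.log_le_log ?_ ?_)
    (Nat.cast_nonneg _))
  · exact_mod_cast ncard_admissible_pos hne _
  · exact_mod_cast (ncard_admissible_quotientImage_le Γ₀ _ F).trans
      (ncard_admissible_mono (Set.sep_subset _ _) F)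

open Pointwise in
/-- Upper semicontinuity of the entropy of periodic parts at the trivial subgroup. -/
theorem eventually_entropy_fixedPart_lt [Finite A] (Y : Subshift A Γ) {c : EReal}
    (hc : entropy Y.carrier < c) :
    ∀ᶠ Γ₀ in 𝓝 (⊥ : AddSubgroup Γ), entropy (quotientImage Γ₀ (fixedPart Y Γ₀)) < c := by
  classical
  rcases Y.carrier.eq_empty_or_nonempty with h | hne
  · refine Eventually.of_forall fun Γ₀ => ?_
    have : quotientImage Γ₀ (fixedPart Y Γ₀) = ∅ :=
      Set.eq_empty_of_forall_notMem fun z ⟨x, hx, _⟩ => by simpa [h] using hx.1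
    rw [this, entropy_empty]
    exact bot_le.trans_lt hc
  · obtain ⟨r, hr1, hr2⟩ := EReal.lt_iff_exists_real_btwn.1 hc
    obtain ⟨F, hF, hlt⟩ := exists_log_ncard_admissible_lt hne hr1
    filter_upwards [eventually_avoidsNonzero (F - F)] with Γ₀ hΓ
    refine (entropy_quotientImage_fixedPart_le Y hF hΓ).trans_lt (lt_trans ?_ hr2)
    rwa [EReal.coe_lt_coe_iff, div_lt_iff₀ (by exact_mod_cast hF.card_pos)]

/-- The entropy of the part fixed by the trivial subgroup. -/
theorem entropy_le_entropy_quotientImage_bot [Finite A] (Y : Subshift A Γ) :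
    entropy Y.carrier ≤ entropy (quotientImage ⊥ (fixedPart Y ⊥)) := by
  classical
  rcases Y.carrier.eq_empty_or_nonempty with h | hne
  · rw [h, entropy_empty]
    exact bot_le
  obtain ⟨h, -, hh, hlow⟩ := exists_entropy_eq hne Y.mapsTo
  have hmem : ∀ y ∈ Y.carrier, ∃ z ∈ quotientImage ⊥ (fixedPart Y ⊥), ∀ v : Γ, y v = z v := by
    intro y hy
    obtain ⟨z, hz⟩ := (le_pointStab_iff_exists (Γ₀ := ⊥) (x := y)).1 bot_le
    exact ⟨z, ⟨y, ⟨hy, bot_le⟩, hz⟩, hz⟩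
  rw [hh]
  refine le_entropy ?_ ?_
  · obtain ⟨y, hy⟩ := hne
    obtain ⟨z, hz, -⟩ := hmem y hy
    exact ⟨z, hz⟩
  filter_upwards [eventually_folnerFilter_nonempty] with F hF
  rw [le_div_iff₀ (by exact_mod_cast hF.card_pos)]
  have hF' : (F.image Quotient.out).card = F.card :=
    Finset.card_image_of_injective _ Quotient.out_injective
  rw [← hF']
  refine (hlow _).trans (Real.log_le_log (by exact_mod_cast ncard_admissible_pos hne _) ?_)
  norm_cast
  have hout : ∀ v : F.image (Quotient.out : Γ ⧸ (⊥ : AddSubgroup Γ) → Γ),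
      ((v : Γ) : Γ ⧸ (⊥ : AddSubgroup Γ)) ∈ F := by
    rintro ⟨v, hv⟩
    obtain ⟨g, hg, rfl⟩ := Finset.mem_image.1 hv
    simpa using hg
  have hsub : admissible Y.carrier (F.image Quotient.out) ⊆
      (fun p v => p ⟨_, hout v⟩) '' admissible (quotientImage ⊥ (fixedPart Y ⊥)) F := by
    rintro _ ⟨y, hy, rfl⟩
    obtain ⟨z, hz, hyz⟩ := hmem y hy
    exact ⟨_, ⟨z, hz, rfl⟩, funext fun v => (hyz v).symm⟩
  exact (Set.ncard_le_ncard hsub (Set.toFinite _)).trans (Set.ncard_image_le (Set.toFinite _))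

end Quotient

/-! ### Uniformly aperiodic colourings -/

section Colouring

variable {G ι : Type*} [AddCommGroup G] [DecidableEq G]

/-- The two translates of the window `W` that are compared at position `u`. -/
def comparedCells (W : Finset G) (g u : G) : Finset G :=
  W.image (u + ·) ∪ W.image (u + · + g)

/-- The colourings supported on `S` in which no two compared windows inside `S` agree. -/
def goodColourings (I : Finset ι) (g : ι → G) (W : ι → Finset G) (S : Finset G) :
    Set (G → Fin 10) :=
  {c | (∀ x ∉ S, c x = 0) ∧ ∀ i ∈ I, ∀ u, comparedCells (W i) (g i) u ⊆ S →
    ∃ w ∈ W i, c (u + w) ≠ c (u + w + g i)}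

omit [AddCommGroup G] [DecidableEq G] in
theorem finite_support_subset (S : Finset G) :
    {c : G → Fin 10 | ∀ x ∉ S, c x = 0}.Finite := by
  refine Set.Finite.of_finite_image (f := fun c (x : S) => c x) (Set.toFinite _) ?_
  intro c hc d hd h
  ext x
  by_cases hx : x ∈ S
  · exact congrArg Fin.val (congrFun h ⟨x, hx⟩)
  · rw [hc x hx, hd x hx]

/-- The colouring `c` on `S`, extended by zero. -/
def cutOff (S : Finset G) (c : G → Fin 10) : G → Fin 10 := fun x => if x ∈ S then c x else 0

variable {I : Finset ι} {g : ι → G} {W : ι → Finset G}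

theorem finite_goodColourings (S : Finset G) : (goodColourings I g W S).Finite :=
  (finite_support_subset S).subset fun _ hc => hc.1

theorem cutOff_mem_goodColourings {S T : Finset G} (h : T ⊆ S) {c : G → Fin 10}
    (hc : cutOff S c ∈ goodColourings I g W S) : cutOff T c ∈ goodColourings I g W T := by
  refine ⟨fun x hx => if_neg hx, fun i hi u hu => ?_⟩
  obtain ⟨w, hw, hne⟩ := hc.2 i hi u (hu.trans h)
  have h1 : u + w ∈ T := hu (Finset.mem_union_left _ (Finset.mem_image_of_mem _ hw))
  have h2 : u + w + g i ∈ T :=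
    hu (Finset.mem_union_right _ (Finset.mem_image_of_mem (u + · + g i) hw))
  refine ⟨w, hw, ?_⟩
  simpa only [cutOff, h1, h2, h h1, h h2, if_true] using hne

/-- The one-point extensions of good colourings of `S`. -/
def colouringExtensions (I : Finset ι) (g : ι → G) (W : ι → Finset G) (S : Finset G) (s : G) :
    Set (G → Fin 10) :=
  {c | (∀ x ∉ insert s S, c x = 0) ∧ cutOff S c ∈ goodColourings I g W S}

theorem finite_colouringExtensions (S : Finset G) (s : G) :
    (colouringExtensions I g W S s).Finite :=
  (finite_support_subset (insert s S)).subset fun _ hc => hc.1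

theorem ten_mul_le_ncard_colouringExtensions {S : Finset G} {s : G} (hs : s ∉ S) :
    10 * (goodColourings I g W S).ncard ≤ (colouringExtensions I g W S s).ncard := by
  have h10 : 10 * (goodColourings I g W S).ncard
      = ((Set.univ : Set (Fin 10)) ×ˢ goodColourings I g W S).ncard := by
    rw [Set.ncard_prod, Set.ncard_univ]
    simp
  rw [h10]
  refine Set.ncard_le_ncard_of_injOn (fun p => Function.update p.2 s p.1) ?_ ?_
    (finite_colouringExtensions S s)
  · rintro ⟨b, c⟩ ⟨-, hc : c ∈ goodColourings I g W S⟩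
    refine ⟨fun x hx => ?_, ?_⟩
    · obtain ⟨h1, h2⟩ := not_or.1 (fun h => hx (Finset.mem_insert.2 h))
      simpa [Function.update_of_ne h1] using hc.1 x h2
    · have : cutOff S (Function.update c s b) = c := by
        ext x
        by_cases hx : x ∈ S
        · have : x ≠ s := fun h => hs (h ▸ hx)
          simp [cutOff, hx, Function.update_of_ne this]
        · simp [cutOff, hx, hc.1 x hx]
      simpa only [this] using hc
  · rintro ⟨b, c⟩ ⟨-, hc : c ∈ goodColourings I g W S⟩ ⟨b', c'⟩
      ⟨-, hc' : c' ∈ goodColourings I g W S⟩ h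
    have hb : b = b' := by simpa using congrFun h s
    refine Prod.ext hb (funext fun x => ?_)
    by_cases hx : x = s
    · exact hx ▸ (hc.1 s hs).trans (hc'.1 s hs).symm
    · have := congrFun h x
      simpa only [Function.update_of_ne hx] using this

/-- Extensions that repeat the colours of a window are determined outside the window. -/
theorem ncard_repeating_le {S H : Finset G} {s : G} (hsH : s ∈ H) (σ : G → G)
    (hσ : ∀ x ∈ H, σ x ∉ H ∧ σ x ∈ insert s S) :
    {c ∈ colouringExtensions I g W S s | ∀ x ∈ H, c x = c (σ x)}.ncard
      ≤ (goodColourings I g W (S \ H)).ncard := by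
  refine Set.ncard_le_ncard_of_injOn (cutOff (S \ H)) ?_ ?_ (finite_goodColourings _)
  · rintro c ⟨hc, -⟩
    exact cutOff_mem_goodColourings Finset.sdiff_subset hc.2
  · rintro c ⟨hc, hcH⟩ d ⟨hd, hdH⟩ h
    have hout : ∀ x ∉ H, c x = d x := by
      intro x hx
      by_cases hxS : x ∈ S
      · simpa [cutOff, hx, hxS] using congrFun h x
      · have : x ∉ insert s S := by
          simp only [Finset.mem_insert, not_or]
          exact ⟨fun h => hx (h ▸ hsH), hxS⟩
        rw [hc.1 x this, hd.1 x this]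
    ext x
    by_cases hx : x ∈ H
    · rw [hcH x hx, hdH x hx, hout _ (hσ x hx).1]
    · rw [hout x hx]

theorem two_pow_mul_ncard_goodColourings_le {S : Finset G}
    (ih : ∀ T : Finset G, T.card < S.card → ∀ t ∉ T,
      2 * (goodColourings I g W T).ncard ≤ (goodColourings I g W (insert t T)).ncard) :
    ∀ (k : ℕ) (T : Finset G), T ⊆ S → (S \ T).card = k →
      2 ^ k * (goodColourings I g W T).ncard ≤ (goodColourings I g W S).ncard := by
  intro k
  induction k with
  | zero =>
    intro T hT h
    have : T = S := hT.antisymm (Finset.sdiff_eq_empty_iff_subset.1 (Finset.card_eq_zero.1 h))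
    simp [this]
  | succ k ihk =>
    intro T hT h
    obtain ⟨t, ht⟩ : (S \ T).Nonempty := by rw [← Finset.card_pos]; omega
    obtain ⟨htS, htT⟩ := Finset.mem_sdiff.1 ht
    have hlt : T.card < S.card := Finset.card_lt_card ⟨hT, fun h => htT (h htS)⟩
    have h1 := ihk (insert t T) (Finset.insert_subset htS hT) (by
      rw [Finset.sdiff_insert, Finset.card_erase_of_mem ht, h]; rfl)
    have h2 := Nat.mul_le_mul_left (2 ^ k) (ih T hlt t htT)
    rw [pow_succ, mul_assoc]
    exact h2.trans h1

/-- Injectivity of `e` bounds the sum by the series Σ 2(j+1)/2^j = 8. This fixes the number of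
colours: 10 - 8 = 2 is the growth factor that the induction reproduces. -/
theorem sum_weights_le (e : ι → ℕ) (he : Set.InjOn e I) :
    ∑ i ∈ I, 2 * ((e i : ℝ) + 1) / 2 ^ e i ≤ 8 := by
  classical
  have hpart : ∀ N : ℕ, ∑ j ∈ Finset.range N, 2 * ((j : ℝ) + 1) / 2 ^ j
      = 8 - (4 * N + 8) / 2 ^ N := by
    intro N
    induction N with
    | zero => norm_num
    | succ N ih =>
      rw [Finset.sum_range_succ, ih]
      push_cast
      field_simp
      ring
  rw [← Finset.sum_image (f := fun j : ℕ => 2 * ((j : ℝ) + 1) / 2 ^ j) he]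
  have hsub : I.image e ⊆ Finset.range ((I.image e).sup id + 1) := fun j hj =>
    Finset.mem_range.2 (Nat.lt_succ_of_le (Finset.le_sup (f := id) hj))
  refine (Finset.sum_le_sum_of_subset_of_nonneg hsub fun _ _ _ => by positivity).trans ?_
  rw [hpart]
  have : (0 : ℝ) ≤ (4 * (((I.image e).sup id + 1 : ℕ) : ℝ) + 8) / 2 ^ ((I.image e).sup id + 1) := by
    positivity
  linarith

/-- Rosenfeld's counting argument: each new cell at least doubles the number of good
colourings. -/
theorem two_mul_ncard_goodColourings_le (e : ι → ℕ) (he : Set.InjOn e I)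
    (hW : ∀ i ∈ I, (W i).card = e i + 1)
    (hdisj : ∀ i ∈ I, Disjoint (W i) ((W i).image (· + g i))) (m : ℕ) :
    ∀ S : Finset G, S.card = m → ∀ s ∉ S,
      2 * (goodColourings I g W S).ncard ≤ (goodColourings I g W (insert s S)).ncard := by
  induction m using Nat.strong_induction_on with
  | _ m ih =>
  intro S hS s hs
  have hdouble := two_pow_mul_ncard_goodColourings_le (I := I) (g := g) (W := W) (S := S)
    fun T hT t ht => ih T.card (hS ▸ hT) T rfl t ht
  set N := (goodColourings I g W S).ncard with hN
  have hne : ∀ i ∈ I, ∀ w ∈ W i, ∀ w' ∈ W i, w' + g i ≠ w := fun i hi w hw w' hw' h =>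
    Finset.disjoint_left.1 (hdisj i hi) hw (Finset.mem_image.2 ⟨w', hw', h⟩)
  let bad : ι → G → Set (G → Fin 10) := fun i u =>
    {c ∈ colouringExtensions I g W S s | comparedCells (W i) (g i) u ⊆ insert s S ∧
      ∀ w ∈ W i, c (u + w) = c (u + w + g i)}
  -- the count for a window `H` of size `e i + 1` through `s`
  have hcount : ∀ i ∈ I, ∀ (H : Finset G) (σ : G → G), s ∈ H → H ⊆ insert s S →
      H.card = e i + 1 → (∀ x ∈ H, σ x ∉ H ∧ σ x ∈ insert s S) → ∀ u,
      (∀ c : G → Fin 10, (∀ w ∈ W i, c (u + w) = c (u + w + g i)) → ∀ x ∈ H, c x = c (σ x)) →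
      ((bad i u).ncard : ℝ) ≤ N / 2 ^ e i := by
    intro i _ H σ hsH hHS hHc hσ u hcH
    have h1 : (bad i u).ncard ≤ (goodColourings I g W (S \ H)).ncard := by
      refine (Set.ncard_le_ncard ?_ ((finite_colouringExtensions S s).subset
        (Set.sep_subset _ _))).trans (ncard_repeating_le hsH σ hσ)
      exact fun c hc => ⟨hc.1, hcH c hc.2.2⟩
    -- The window has `e i + 1` cells, but one of them is the new cell `s`, which is not in `S`;
    -- doubling is available only for the other `e i`.
    have h2 : (S \ (S \ H)).card = e i := by
      have : S \ (S \ H) = H.erase s := by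
        ext x
        simp only [Finset.mem_sdiff, Finset.mem_erase, not_and, not_not]
        constructor
        · rintro ⟨hx, hx'⟩
          exact ⟨fun h => hs (h ▸ hx), hx' hx⟩
        · rintro ⟨hx, hx'⟩
          exact ⟨(Finset.mem_insert.1 (hHS hx')).resolve_left hx, fun _ => hx'⟩
      rw [this, Finset.card_erase_of_mem hsH, hHc]
      rfl
    have h3 := hdouble _ (S \ H) Finset.sdiff_subset h2
    rw [le_div_iff₀ (by positivity), mul_comm]
    exact_mod_cast (Nat.mul_le_mul_left _ h1).trans h3
  have hbad1 : ∀ i ∈ I, ∀ w ∈ W i, ((bad i (s - w)).ncard : ℝ) ≤ N / 2 ^ e i := by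
    intro i hi w hw
    by_cases hcell : comparedCells (W i) (g i) (s - w) ⊆ insert s S
    · refine hcount i hi ((W i).image (s - w + ·)) (· + g i) ?_ ?_ ?_ ?_ (s - w) ?_
      · exact Finset.mem_image.2 ⟨w, hw, by abel⟩
      · exact Finset.subset_union_left.trans hcell
      · rw [Finset.card_image_of_injective _ (add_right_injective _), hW i hi]
      · intro x hx
        obtain ⟨w', hw', rfl⟩ := Finset.mem_image.1 hx
        refine ⟨fun h => ?_, hcell (Finset.mem_union_right _
          (Finset.mem_image_of_mem (s - w + · + g i) hw'))⟩
        obtain ⟨w'', hw'', h⟩ := Finset.mem_image.1 h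
        exact hne i hi w'' hw'' w' hw' (by rw [add_assoc] at h; exact (add_left_cancel h).symm)
      · intro c hc x hx
        obtain ⟨w', hw', rfl⟩ := Finset.mem_image.1 hx
        exact hc w' hw'
    · have : bad i (s - w) = ∅ := Set.eq_empty_of_forall_notMem fun c hc => hcell hc.2.1
      rw [this, Set.ncard_empty, Nat.cast_zero]
      positivity
  have hbad2 : ∀ i ∈ I, ∀ w ∈ W i, ((bad i (s - w - g i)).ncard : ℝ) ≤ N / 2 ^ e i := by
    intro i hi w hw
    by_cases hcell : comparedCells (W i) (g i) (s - w - g i) ⊆ insert s S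
    · refine hcount i hi ((W i).image (s - w - g i + · + g i)) (· - g i) ?_ ?_ ?_ ?_
        (s - w - g i) ?_
      · exact Finset.mem_image.2 ⟨w, hw, by abel⟩
      · exact Finset.subset_union_right.trans hcell
      · rw [Finset.card_image_of_injective _
          (fun a b h => add_left_cancel (add_right_cancel h)), hW i hi]
      · intro x hx
        obtain ⟨w', hw', rfl⟩ := Finset.mem_image.1 hx
        have hx' : s - w - g i + w' + g i - g i = s - w - g i + w' := by abel
        simp only [hx']
        refine ⟨fun h => ?_, hcell (Finset.mem_union_left _ (Finset.mem_image_of_mem _ hw'))⟩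
        obtain ⟨w'', hw'', h⟩ := Finset.mem_image.1 h
        exact hne i hi w' hw' w'' hw'' (by rw [add_assoc] at h; exact add_left_cancel h)
      · intro c hc x hx
        obtain ⟨w', hw', rfl⟩ := Finset.mem_image.1 hx
        have hx' : s - w - g i + w' + g i - g i = s - w - g i + w' := by abel
        simp only [hx']
        exact (hc w' hw').symm
    · have : bad i (s - w - g i) = ∅ := Set.eq_empty_of_forall_notMem fun c hc => hcell hc.2.1
      rw [this, Set.ncard_empty, Nat.cast_zero]
      positivity
  -- The restriction to `S` is already good, so a violated comparison must involve `s`, in its first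
  -- or in its second window. This leaves 2(`e i` + 1) positions for each `i`.
  have hcover : colouringExtensions I g W S s ⊆ goodColourings I g W (insert s S) ∪
      ⋃ i ∈ I, ⋃ w ∈ W i, (bad i (s - w) ∪ bad i (s - w - g i)) := by
    intro c hc
    by_contra hcon
    obtain ⟨h1, h2⟩ := not_or.1 hcon
    refine h1 ⟨hc.1, fun i hi u hu => ?_⟩
    by_contra! hall
    have hmem : c ∈ bad i u := ⟨hc, hu, hall⟩
    by_cases hsu : s ∈ comparedCells (W i) (g i) u
    · refine h2 (Set.mem_biUnion hi ?_)
      rcases Finset.mem_union.1 hsu with h | h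
      · obtain ⟨w, hw, rfl⟩ := Finset.mem_image.1 h
        exact Set.mem_biUnion hw (Or.inl (by rwa [add_sub_cancel_right]))
      · obtain ⟨w, hw, rfl⟩ := Finset.mem_image.1 h
        refine Set.mem_biUnion hw (Or.inr ?_)
        rwa [show u + w + g i - w - g i = u by abel]
    · have huS : comparedCells (W i) (g i) u ⊆ S := fun x hx =>
        (Finset.mem_insert.1 (hu hx)).resolve_left fun h => hsu (h ▸ hx)
      obtain ⟨w, hw, hne⟩ := hc.2.2 i hi u huS
      have hx1 : u + w ∈ S := huS (Finset.mem_union_left _ (Finset.mem_image_of_mem _ hw))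
      have hx2 : u + w + g i ∈ S :=
        huS (Finset.mem_union_right _ (Finset.mem_image_of_mem (u + · + g i) hw))
      simp only [cutOff, hx1, hx2, if_true] at hne
      exact hne (hall w hw)
  have hfin : (⋃ i ∈ I, ⋃ w ∈ W i, (bad i (s - w) ∪ bad i (s - w - g i))).Finite := by
    refine (finite_colouringExtensions (I := I) (g := g) (W := W) S s).subset ?_
    simp only [Set.iUnion_subset_iff, Set.union_subset_iff]
    exact fun i _ w _ => ⟨Set.sep_subset _ _, Set.sep_subset _ _⟩
  have hsum : ((⋃ i ∈ I, ⋃ w ∈ W i, (bad i (s - w) ∪ bad i (s - w - g i))).ncard : ℝ)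
      ≤ 8 * N := by
    have h1 : ((⋃ i ∈ I, ⋃ w ∈ W i, (bad i (s - w) ∪ bad i (s - w - g i))).ncard : ℝ)
        ≤ ∑ i ∈ I, ∑ w ∈ W i, ((bad i (s - w)).ncard + (bad i (s - w - g i)).ncard : ℝ) := by
      refine le_trans (Nat.cast_le.2 (Finset.set_ncard_biUnion_le I _)) ?_
      push_cast
      refine Finset.sum_le_sum fun i _ => ?_
      refine le_trans (Nat.cast_le.2 (Finset.set_ncard_biUnion_le (W i) _)) ?_
      push_cast
      refine Finset.sum_le_sum fun w _ => ?_
      exact_mod_cast Set.ncard_union_le _ _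
    have h2 : ∑ i ∈ I, ∑ w ∈ W i, ((bad i (s - w)).ncard + (bad i (s - w - g i)).ncard : ℝ)
        ≤ ∑ i ∈ I, (2 * ((e i : ℝ) + 1) / 2 ^ e i) * N := by
      refine Finset.sum_le_sum fun i hi => ?_
      refine (Finset.sum_le_sum fun w hw => add_le_add (hbad1 i hi w hw)
        (hbad2 i hi w hw)).trans (le_of_eq ?_)
      rw [Finset.sum_const, hW i hi, nsmul_eq_mul]
      push_cast
      ring
    refine h1.trans (h2.trans ?_)
    rw [← Finset.sum_mul]
    exact mul_le_mul_of_nonneg_right (sum_weights_le e he) (Nat.cast_nonneg _)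
  have h1 := ten_mul_le_ncard_colouringExtensions (I := I) (g := g) (W := W) hs
  have h2 := (Set.ncard_le_ncard hcover ((finite_goodColourings _).union hfin)).trans
    (Set.ncard_union_le _ _)
  have h3 : (10 * N : ℝ) ≤ (goodColourings I g W (insert s S)).ncard
      + (⋃ i ∈ I, ⋃ w ∈ W i, (bad i (s - w) ∪ bad i (s - w - g i))).ncard := by
    exact_mod_cast h1.trans h2
  have h4 : (2 * N : ℝ) ≤ (goodColourings I g W (insert s S)).ncard := by linarith
  exact_mod_cast h4

theorem goodColourings_nonempty (e : ι → ℕ) (he : Set.InjOn e I)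
    (hW : ∀ i ∈ I, (W i).card = e i + 1)
    (hdisj : ∀ i ∈ I, Disjoint (W i) ((W i).image (· + g i))) (S : Finset G) :
    (goodColourings I g W S).Nonempty := by
  rw [← Set.ncard_pos (finite_goodColourings S)]
  induction S using Finset.induction_on with
  | empty =>
    refine (Set.ncard_pos (finite_goodColourings ∅)).2 ⟨0, fun _ _ => rfl, fun i hi u hu => ?_⟩
    obtain ⟨w, hw⟩ : (W i).Nonempty := by rw [← Finset.card_pos, hW i hi]; omega
    exact absurd (hu (Finset.mem_union_left _ (Finset.mem_image_of_mem _ hw)))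
      (Finset.notMem_empty _)
  | insert s S hs ih =>
    have := two_mul_ncard_goodColourings_le e he hW hdisj S.card S rfl s hs
    omega

/-- Colourings of the whole group without repetition in any compared pair of windows. -/
theorem exists_colouring (e : ι → ℕ) (he : Set.InjOn e I)
    (hW : ∀ i ∈ I, (W i).card = e i + 1)
    (hdisj : ∀ i ∈ I, Disjoint (W i) ((W i).image (· + g i))) :
    ∃ c : G → Fin 10, ∀ i ∈ I, ∀ u, ∃ w ∈ W i, c (u + w) ≠ c (u + w + g i) := by
  let C : Finset G → Set (G → Fin 10) := fun S =>
    {c | ∀ i ∈ I, ∀ u, comparedCells (W i) (g i) u ⊆ S → ∃ w ∈ W i, c (u + w) ≠ c (u + w + g i)}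
  have hclosed : ∀ S, IsClosed (C S) := by
    intro S
    have : C S = ⋂ i ∈ I, ⋂ u, ⋂ (_ : comparedCells (W i) (g i) u ⊆ S),
        ⋃ w ∈ W i, {c : G → Fin 10 | c (u + w) ≠ c (u + w + g i)} := by
      ext c; simp [C]
    rw [this]
    refine isClosed_biInter fun i _ => isClosed_iInter fun u => isClosed_iInter fun _ => ?_
    refine isClosed_biUnion_finset fun w _ => ?_
    have hcont : Continuous fun c : G → Fin 10 => (c (u + w), c (u + w + g i)) := by fun_prop
    exact (isClosed_discrete {p : Fin 10 × Fin 10 | p.1 ≠ p.2}).preimage hcont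
  have hne : (⋂ S, C S).Nonempty := by
    refine IsCompact.nonempty_iInter_of_directed_nonempty_isCompact_isClosed C ?_ ?_
      (fun S => (hclosed S).isCompact) hclosed
    · intro S T
      exact ⟨S ∪ T, fun c hc i hi u hu => hc i hi u (hu.trans Finset.subset_union_left),
        fun c hc i hi u hu => hc i hi u (hu.trans Finset.subset_union_right)⟩
    · intro S
      obtain ⟨c, hc⟩ := goodColourings_nonempty e he hW hdisj S
      exact ⟨c, hc.2⟩
  obtain ⟨c, hc⟩ := hne
  exact ⟨c, fun i hi u => Set.mem_iInter.1 hc (comparedCells (W i) (g i) u) i hi u subset_rfl⟩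

end Colouring

/-! ### Marker subshifts -/

section Marker

variable {Γ : Type*} [AddCommGroup Γ]

/-- The colourings that distinguish, for each nonzero `v ∈ V`, every translate of the window `W v`
from its translate by `v`. -/
def markerSubshift (W : Γ → Finset Γ) (V : Set Γ) : Subshift (Fin 10) Γ where
  carrier := {t | ∀ v ∈ V, v ≠ 0 → ∀ u, ∃ w ∈ W v, t (u + w) ≠ t (u + w + v)}
  isClosed := by
    have : {t : Γ → Fin 10 | ∀ v ∈ V, v ≠ 0 → ∀ u, ∃ w ∈ W v, t (u + w) ≠ t (u + w + v)}
        = ⋂ v ∈ V, ⋂ (_ : v ≠ 0), ⋂ u,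
          ⋃ w ∈ W v, {t : Γ → Fin 10 | t (u + w) ≠ t (u + w + v)} := by
      ext t; simp
    rw [this]
    refine isClosed_biInter fun v _ => isClosed_iInter fun _ => isClosed_iInter fun u => ?_
    refine isClosed_biUnion_finset fun w _ => ?_
    have hcont : Continuous fun t : Γ → Fin 10 => (t (u + w), t (u + w + v)) := by fun_prop
    exact (isClosed_discrete {p : Fin 10 × Fin 10 | p.1 ≠ p.2}).preimage hcont
  mapsTo := by
    intro g t ht v hv hv0 u
    obtain ⟨w, hw, h⟩ := ht v hv hv0 (g + u)
    exact ⟨w, hw, by simpa only [shift_apply, add_assoc] using h⟩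

theorem markerSubshift_anti (W : Γ → Finset Γ) {V V' : Set Γ} (h : V ⊆ V') :
    (markerSubshift W V').carrier ⊆ (markerSubshift W V).carrier :=
  fun _ ht v hv => ht v (h hv)

theorem pointStab_eq_bot_of_mem_markerSubshift {W : Γ → Finset Γ} {t : Γ → Fin 10}
    (ht : t ∈ (markerSubshift W Set.univ).carrier) : pointStab t = ⊥ := by
  rw [eq_bot_iff]
  intro v hv
  by_contra hne
  obtain ⟨w, -, h⟩ := ht v trivial (fun h => hne (h ▸ zero_mem _)) 0
  exact h (by rw [add_comm _ v, mem_pointStab.1 hv])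

/-- An infinite group leaves room to add cells one at a time outside W, W + v and W - v. The sizes
are prescribed so that an injective `e` makes the weights of Rosenfeld's count summable. -/
theorem exists_windows [Infinite Γ] [DecidableEq Γ] (e : Γ → ℕ) :
    ∃ W : Γ → Finset Γ, ∀ v, v ≠ 0 →
      (W v).card = e v + 1 ∧ Disjoint (W v) ((W v).image (· + v)) := by
  have key : ∀ v : Γ, v ≠ 0 → ∀ k : ℕ, ∃ W : Finset Γ, W.card = k ∧
      Disjoint W (W.image (· + v)) := by
    intro v hv k
    induction k with
    | zero => exact ⟨∅, rfl, by simp⟩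
    | succ k ih =>
      obtain ⟨W, hWk, hW⟩ := ih
      obtain ⟨w, hw⟩ := Infinite.exists_notMem_finset (W ∪ W.image (· + v) ∪ W.image (· - v))
      simp only [Finset.mem_union, not_or] at hw
      obtain ⟨⟨h1, h2⟩, h3⟩ := hw
      refine ⟨insert w W, by rw [Finset.card_insert_of_notMem h1, hWk], ?_⟩
      rw [Finset.image_insert, Finset.disjoint_insert_left, Finset.disjoint_insert_right]
      refine ⟨?_, ?_, hW⟩
      · rw [Finset.mem_insert, not_or]
        exact ⟨fun h => hv (by simpa using h), h2⟩
      · exact fun h => h3 (Finset.mem_image.2 ⟨w + v, h, by abel⟩)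
  choose! W hW using fun v (hv : v ≠ 0) => key v hv (e v + 1)
  exact ⟨W, hW⟩

open Pointwise in
/-- Marker colourings with a prescribed small group of periods. -/
theorem exists_periodic_marker [DecidableEq Γ] {e : Γ → ℕ} (he : Function.Injective e)
    {W : Γ → Finset Γ} (hW : ∀ v, v ≠ 0 →
      (W v).card = e v + 1 ∧ Disjoint (W v) ((W v).image (· + v))) (V : Finset Γ) :
    ∃ V' : Finset Γ, ∀ Γ₀ : AddSubgroup Γ, AvoidsNonzero Γ₀ V' →
      ∃ t ∈ (markerSubshift W V).carrier, Γ₀ ≤ pointStab t := by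
  classical
  let Z : Γ → Finset Γ := fun v => W v ∪ (W v).image (· + v)
  -- For such Γ₀ each window together with its translate embeds in Γ/Γ₀, so sizes and disjointness
  -- persist there. The colouring is built on the quotient, with the same windows for every Γ₀, and
  -- pulled back.
  refine ⟨V.biUnion fun v => Z v - Z v, fun Γ₀ hΓ => ?_⟩
  have hinj : ∀ v ∈ V, Set.InjOn (QuotientAddGroup.mk : Γ → Γ ⧸ Γ₀) (Z v) := fun v hv =>
    (hΓ.mono (Finset.subset_biUnion_of_mem (fun v => Z v - Z v) hv)).injOn_mk
  obtain ⟨c, hc⟩ := exists_colouring (I := V.filter (· ≠ 0))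
    (g := fun v => (QuotientAddGroup.mk v : Γ ⧸ Γ₀))
    (W := fun v => (W v).image (QuotientAddGroup.mk : Γ → Γ ⧸ Γ₀)) e he.injOn (by
      intro v hv
      obtain ⟨hvV, hv0⟩ := Finset.mem_filter.1 hv
      rw [Finset.card_image_of_injOn ((hinj v hvV).mono
        (Finset.coe_subset.2 Finset.subset_union_left)), (hW v hv0).1]) (by
      intro v hv
      obtain ⟨hvV, hv0⟩ := Finset.mem_filter.1 hv
      rw [Finset.disjoint_left]
      intro x hx hx'
      obtain ⟨w, hw, rfl⟩ := Finset.mem_image.1 hx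
      obtain ⟨y, hy, h⟩ := Finset.mem_image.1 hx'
      obtain ⟨w', hw', rfl⟩ := Finset.mem_image.1 hy
      rw [← QuotientAddGroup.mk_add] at h
      have h2 : w' + v ∈ (W v).image (· + v) := Finset.mem_image_of_mem (· + v) hw'
      have := hinj v hvV (Finset.mem_coe.2 (Finset.mem_union_right _ h2))
        (Finset.mem_coe.2 (Finset.mem_union_left _ hw)) h
      exact Finset.disjoint_left.1 (hW v hv0).2 hw (this ▸ h2))
  refine ⟨fun v => c v, ?_, le_pointStab_iff_exists.2 ⟨c, fun _ => rfl⟩⟩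
  intro v hv hv0 u
  obtain ⟨x, hx, h⟩ := hc v (Finset.mem_filter.2 ⟨hv, hv0⟩) u
  obtain ⟨w, hw, rfl⟩ := Finset.mem_image.1 hx
  exact ⟨w, hw, h⟩

theorem markerSubshift_univ_nonempty [DecidableEq Γ] {e : Γ → ℕ} (he : Function.Injective e)
    {W : Γ → Finset Γ} (hW : ∀ v, v ≠ 0 →
      (W v).card = e v + 1 ∧ Disjoint (W v) ((W v).image (· + v))) :
    (markerSubshift W Set.univ).carrier.Nonempty := by
  have hne : (⋂ V : Finset Γ, (markerSubshift W (V : Set Γ)).carrier).Nonempty := by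
    refine IsCompact.nonempty_iInter_of_directed_nonempty_isCompact_isClosed _ ?_ ?_
      (fun V => (markerSubshift W _).isClosed.isCompact) fun V => (markerSubshift W _).isClosed
    · intro S T
      exact ⟨S ∪ T, markerSubshift_anti W (by simp), markerSubshift_anti W (by simp)⟩
    · intro V
      obtain ⟨V', hV'⟩ := exists_periodic_marker he hW V
      obtain ⟨t, ht, -⟩ := hV' ⊥ (avoidsNonzero_bot V')
      exact ⟨t, ht⟩
  obtain ⟨t, ht⟩ := hne
  exact ⟨t, fun v _ => Set.mem_iInter.1 ht {v} v (by simp)⟩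

open Pointwise in
/-- Changing a marker colouring on a finite set preserves aperiodicity, with larger windows. -/
theorem exists_windows_of_modify [Infinite Γ] [DecidableEq Γ] {W : Γ → Finset Γ}
    {t : Γ → Fin 10} (ht : t ∈ (markerSubshift W Set.univ).carrier) (D : Finset Γ) (b : Fin 10) :
    ∃ W' : Γ → Finset Γ,
      (fun x => if x ∈ D then b else t x) ∈ (markerSubshift W' Set.univ).carrier := by
  let Z : Γ → Finset Γ := fun v => W v ∪ (W v).image (· + v)
  -- If u + Z v meets `D`, then its further translate by `a v` misses `D`, and the comparison there
  -- is unaffected by the change.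
  choose a ha using fun v => Infinite.exists_notMem_finset ((D - D) + (Z v - Z v))
  refine ⟨fun v => W v ∪ (W v).image (a v + ·), fun v _ hv0 u => ?_⟩
  have hZ1 : ∀ w ∈ W v, w ∈ Z v := fun w hw => Finset.mem_union_left _ hw
  have hZ2 : ∀ w ∈ W v, w + v ∈ Z v := fun w hw =>
    Finset.mem_union_right _ (Finset.mem_image_of_mem (· + v) hw)
  by_cases h : ∃ z ∈ Z v, u + z ∈ D
  · obtain ⟨z, hz, hzD⟩ := h
    have hout : ∀ z' ∈ Z v, u + a v + z' ∉ D := by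
      intro z' hz' hD
      refine ha v (Finset.mem_add.2 ⟨_, Finset.sub_mem_sub hD hzD, _,
        Finset.sub_mem_sub hz hz', by abel⟩)
    obtain ⟨w, hw, hne⟩ := ht v trivial hv0 (u + a v)
    refine ⟨a v + w, Finset.mem_union_right _ (Finset.mem_image_of_mem _ hw), ?_⟩
    have h1 := hout _ (hZ1 w hw)
    have h2 := hout _ (hZ2 w hw)
    rw [← add_assoc] at h2
    simpa only [← add_assoc, h1, h2, if_false] using hne
  · push Not at h
    obtain ⟨w, hw, hne⟩ := ht v trivial hv0 u
    refine ⟨w, Finset.mem_union_left _ hw, ?_⟩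
    have h1 := h _ (hZ1 w hw)
    have h2 := h _ (hZ2 w hw)
    rw [← add_assoc] at h2
    simpa only [h1, h2, if_false] using hne

end Marker

/-! ### Local rules -/

section LocalRules

variable {Γ : Type*} [AddCommGroup Γ]

/-- The configurations whose letterwise image under `h` lies in a given subshift. -/
def letterPreimage {C D : Type*} [TopologicalSpace C] [TopologicalSpace D] [DiscreteTopology D]
    (h : D → C) (S : Subshift C Γ) : Subshift D Γ where
  carrier := {x | h ∘ x ∈ S.carrier}
  isClosed := S.isClosed.preimage
    (continuous_pi fun _ => continuous_of_discreteTopology.comp (continuous_apply _))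
  mapsTo := fun v _ hx => S.mapsTo v hx

/-- The intersection of two subshifts. -/
def interSubshift {D : Type*} [TopologicalSpace D] (S T : Subshift D Γ) : Subshift D Γ where
  carrier := S.carrier ∩ T.carrier
  isClosed := S.isClosed.inter T.isClosed
  mapsTo := fun v _ hx => ⟨S.mapsTo v hx.1, T.mapsTo v hx.2⟩

theorem pointStab_le_comp {C D : Type*} (h : D → C) (x : Γ → D) :
    pointStab x ≤ pointStab (h ∘ x) := fun _ hv =>
  mem_pointStab.2 fun u => congrArg h (mem_pointStab.1 hv u)

variable {A D : Type*} [TopologicalSpace D]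

omit [AddCommGroup Γ] in
theorem exists_cylinder_subset {x : Γ → D} {U : Set (Γ → D)} (hU : U ∈ 𝓝 x) :
    ∃ K : Finset Γ, cylinder K x ⊆ U := by
  obtain ⟨V, hVU, hV, hxV⟩ := mem_nhds_iff.1 hU
  obtain ⟨K, u, hu, hsub⟩ := isOpen_pi_iff.1 hV x hxV
  refine ⟨K, fun y hy => hVU (hsub fun i hi => ?_)⟩
  rw [hy i hi]
  exact (hu i hi).2

omit [AddCommGroup Γ] in
theorem continuous_of_finite_window [DiscreteTopology D] [TopologicalSpace A] {ρ : (Γ → D) → A} {K : Finset Γ}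
    (h : ∀ x x', (∀ w ∈ K, x w = x' w) → ρ x = ρ x') : Continuous ρ := by
  refine IsLocallyConstant.continuous ((IsLocallyConstant.iff_exists_open ρ).2 fun x =>
    ⟨cylinder K x, isOpen_cylinder K x, fun _ _ => rfl, fun y hy => h y x hy⟩)

omit [AddCommGroup Γ] in
/-- A continuous function on a compact set of configurations with values in a discrete space
depends on finitely many coordinates. -/
theorem exists_finite_window [DiscreteTopology D] [TopologicalSpace A] [DiscreteTopology A] {X : Set (Γ → D)}
    (hX : IsCompact X) {f : X → A} (hf : Continuous f) :
    ∃ K : Finset Γ, ∀ x x' : X, (∀ w ∈ K, x.1 w = x'.1 w) → f x = f x' := by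
  classical
  have hloc : ∀ x : X, ∃ K : Finset Γ, ∀ x' : X, x'.1 ∈ cylinder K x.1 → f x' = f x := by
    intro x
    have hopen : f ⁻¹' {f x} ∈ 𝓝 x :=
      (isOpen_discrete {f x}).preimage hf |>.mem_nhds rfl
    obtain ⟨U, hU, hUf⟩ := mem_nhds_subtype _ _ _ |>.1 hopen
    obtain ⟨K, hK⟩ := exists_cylinder_subset hU
    exact ⟨K, fun x' hx' => hUf (hK hx')⟩
  choose K hK using hloc
  obtain ⟨s, hs⟩ := hX.elim_nhds_subcover' (fun x hx => cylinder (K ⟨x, hx⟩) x)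
    fun x hx => (isOpen_cylinder _ _).mem_nhds fun _ _ => rfl
  refine ⟨s.biUnion K, fun x x' h => ?_⟩
  obtain ⟨x₀, hx₀, hmem⟩ := Set.mem_iUnion₂.1 (hs x.2)
  rw [hK x₀ x hmem, hK x₀ x' fun w hw => ?_]
  rw [← h w (Finset.mem_biUnion.2 ⟨x₀, hx₀, hw⟩)]
  exact hmem w hw

/-- The equivariant map on configurations with local rule `ρ`. -/
def slidingMap (ρ : (Γ → D) → A) (x : Γ → D) : Γ → A := fun u => ρ (shift u x)

theorem continuous_slidingMap [TopologicalSpace A] {ρ : (Γ → D) → A} (hρ : Continuous ρ) :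
    Continuous (slidingMap ρ) :=
  continuous_pi fun u => hρ.comp (continuous_shift u)

end LocalRules

/-! ### Gluing of patterns in subshifts with the map extension property -/

section Gluing

variable {Γ : Type*} [AddCommGroup Γ] {A : Type*}

theorem le_pointStab_slidingMap {D : Type*} (ρ : (Γ → D) → A) (x : Γ → D) :
    pointStab x ≤ pointStab (slidingMap ρ x) := by
  intro v hv
  refine mem_pointStab.2 fun u => ?_
  simp only [slidingMap]
  rw [shift_add, show shift v x = x from hv]

variable [TopologicalSpace A]

theorem stabDominated_of_free {D : Type*} [TopologicalSpace D] {X : Subshift D Γ}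
    {Y : Subshift A Γ} (hX : ∀ x ∈ X.carrier, pointStab x = ⊥) (hY : Y.carrier.Nonempty) :
    StabDominated X Y := by
  intro x hx
  obtain ⟨y, hy⟩ := hY
  exact ⟨y, hy, (hX x hx).trans_le bot_le⟩

/-- A map given by a local rule on `X` is determined by the rule. -/
theorem IsSubshiftMap.eq_slidingMap {D : Type*} [TopologicalSpace D] {X : Subshift D Γ}
    {Y : Subshift A Γ} {f : X.carrier → Y.carrier} (hf : IsSubshiftMap X Y f)
    {ρ : (Γ → D) → A} {T : Set (Γ → D)} (hT : ∀ v, Set.MapsTo (shift v) T T)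
    (hTX : T ⊆ X.carrier) (h : ∀ x (hx : x ∈ T), ρ x = (f ⟨x, hTX hx⟩).1 0)
    {x : Γ → D} (hx : x ∈ T) : slidingMap ρ x = (f ⟨x, hTX hx⟩).1 := by
  ext u
  have h1 := congrFun (hf.2 u ⟨x, hTX hx⟩) 0
  rw [shift_apply, add_zero] at h1
  rw [← h1]
  exact h _ (hT u hx)

variable [DiscreteTopology A] {Y : Subshift A Γ}

/-- If a local rule maps the free subshift `⋂ P n` into `Y`, then for some `n` it maps all free
subshifts of `P n` into `Y`. -/
theorem HasMapExtensionProperty.exists_slidingMap_mem (hY : HasMapExtensionProperty Y)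
    (hYne : Y.carrier.Nonempty) {D : Type} [Finite D] [TopologicalSpace D] [DiscreteTopology D]
    (P : ℕ → Subshift D Γ) (hP : ∀ m n, m ≤ n → (P n).carrier ⊆ (P m).carrier)
    (hfree : ∀ x, (∀ n, x ∈ (P n).carrier) → pointStab x = ⊥)
    {ρ : (Γ → D) → A} (hρ : Continuous ρ)
    (hρY : ∀ x, (∀ n, x ∈ (P n).carrier) → slidingMap ρ x ∈ Y.carrier) :
    ∃ n, ∀ T : Subshift D Γ, T.carrier ⊆ (P n).carrier →
      (∀ x ∈ T.carrier, pointStab x = ⊥) → ∀ x ∈ T.carrier, slidingMap ρ x ∈ Y.carrier := by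
  by_contra! hcon
  choose T hTP hTfree x hxT hxY using hcon
  let X' : Subshift D Γ :=
    { carrier := ⋂ n, (P n).carrier
      isClosed := isClosed_iInter fun n => (P n).isClosed
      mapsTo := fun v x hx => Set.mem_iInter.2 fun n => (P n).mapsTo v (Set.mem_iInter.1 hx n) }
  -- This is the union of ⋂ P n and all T k, written so that closedness is visible: a point of it
  -- outside every T k lies in every P n. Hence it is free, and the extension property applies.
  let X : Subshift D Γ :=
    { carrier := ⋂ n, ((P n).carrier ∪ ⋃ k ∈ Finset.range n, (T k).carrier)
      isClosed := isClosed_iInter fun n => (P n).isClosed.union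
        (isClosed_biUnion_finset fun k _ => (T k).isClosed)
      mapsTo := fun v x hx => Set.mem_iInter.2 fun n => by
        rcases Set.mem_iInter.1 hx n with h | h
        · exact Or.inl ((P n).mapsTo v h)
        · obtain ⟨k, hk, h⟩ := Set.mem_iUnion₂.1 h
          exact Or.inr (Set.mem_biUnion hk ((T k).mapsTo v h)) }
  have hX'X : X'.carrier ⊆ X.carrier := Set.iInter_mono fun n => Set.subset_union_left
  have hTX : ∀ n, (T n).carrier ⊆ X.carrier := by
    intro n x hx
    refine Set.mem_iInter.2 fun m => ?_
    rcases lt_or_ge n m with h | h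
    · exact Or.inr (Set.mem_biUnion (Finset.mem_range.2 h) hx)
    · exact Or.inl (hP m n h (hTP n hx))
  have hXfree : ∀ x ∈ X.carrier, pointStab x = ⊥ := by
    intro x hx
    by_cases h : ∃ k, x ∈ (T k).carrier
    · obtain ⟨k, hk⟩ := h
      exact hTfree k x hk
    · refine hfree x fun n => (Set.mem_iInter.1 hx n).resolve_right fun hn => h ?_
      obtain ⟨k, -, hk⟩ := Set.mem_iUnion₂.1 hn
      exact ⟨k, hk⟩
  let f' : X'.carrier → Y.carrier := fun x => ⟨slidingMap ρ x.1, hρY x.1 (Set.mem_iInter.1 x.2)⟩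
  have hf' : IsSubshiftMap X' Y f' := by
    refine ⟨((continuous_slidingMap hρ).comp continuous_subtype_val).subtype_mk _, ?_⟩
    intro v x
    ext u
    simp only [f', slidingMap, shift_apply, ← shift_add]
  obtain ⟨f, hf, hff'⟩ := hY D X X' hX'X (stabDominated_of_free hXfree hYne) f' hf'
  have hXc : CompactSpace X.carrier := isCompact_iff_compactSpace.1 X.isClosed.isCompact
  have hcont : Continuous fun x : X.carrier => (ρ x.1, (f x).1 0) :=
    (hρ.comp continuous_subtype_val).prodMk
      ((continuous_apply 0).comp (continuous_subtype_val.comp hf.1))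
  -- Decreasing closed sets with empty intersection, because `f` is given by `ρ` on ⋂ P n. By
  -- compactness some `E n` is empty, so `ρ` computes `f` on T n and its image there lies in Y, a
  -- contradiction.
  let E : ℕ → Set X.carrier := fun n =>
    {x | ρ x.1 ≠ (f x).1 0} ∩ {x | x.1 ∈ (P n).carrier}
  have hE : ∀ n, IsClosed (E n) := fun n =>
    ((isClosed_discrete {p : A × A | p.1 ≠ p.2}).preimage hcont).inter
      ((P n).isClosed.preimage continuous_subtype_val)
  have hempty : ∃ n, E n = ∅ := by
    by_contra! hne
    obtain ⟨x, hx⟩ := IsCompact.nonempty_iInter_of_sequence_nonempty_isCompact_isClosed E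
      (fun n => Set.inter_subset_inter_right _ fun x hx => hP n (n + 1) (Nat.le_succ n) hx)
      hne (hE 0).isCompact hE
    have hxP : ∀ n, x.1 ∈ (P n).carrier := fun n => (Set.mem_iInter.1 hx n).2
    have h1 : x.1 ∈ X'.carrier := Set.mem_iInter.2 hxP
    refine (Set.mem_iInter.1 hx 0).1 ?_
    have h2 : f x = f' ⟨x.1, h1⟩ := hff' x.1 h1
    rw [h2]
    simp [f', slidingMap]
  obtain ⟨n, hn⟩ := hempty
  refine hxY n ?_
  rw [hf.eq_slidingMap (T n).mapsTo (hTX n) (fun y hy => ?_) (hxT n)]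
  · exact (f _).2
  · by_contra hne
    exact Set.eq_empty_iff_forall_notMem.1 hn ⟨y, hTX n hy⟩ ⟨hne, hTP n hy⟩

/-- The window `u + K` of `z` is admissible for `Y`. -/
def AdmissibleAt (Y : Subshift A Γ) (K : Finset Γ) (z : Γ → A) (u : Γ) : Prop :=
  ∃ y ∈ Y.carrier, ∀ w ∈ K, y (u + w) = z (u + w)

/-- A map from `A^Γ × S`, for a free subshift `S`, to `Y`, given by a local rule that copies the
first coordinate wherever it is locally admissible. -/
theorem HasMapExtensionProperty.exists_copying_rule [Finite A] (hY : HasMapExtensionProperty Y)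
    (hYne : Y.carrier.Nonempty) {C D : Type} [Finite D] [TopologicalSpace D] [DiscreteTopology D]
    [TopologicalSpace C] [DiscreteTopology C] (S : Subshift C Γ)
    (hS : ∀ t ∈ S.carrier, pointStab t = ⊥) (e : D ≃ A × C) :
    ∃ (K : Finset Γ) (ρ : (Γ → D) → A), (0 : Γ) ∈ K ∧ Continuous ρ ∧
      (∀ x, (fun v => (e (x v)).2) ∈ S.carrier → slidingMap ρ x ∈ Y.carrier) ∧
      ∀ x, AdmissibleAt Y K (fun v => (e (x v)).1) 0 → ρ x = (e (x 0)).1 := by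
  classical
  -- `X` is A^Γ × S and `X'` is Y × S; the map to be extended is the projection to Y. Freeness of S
  -- makes the stabilizer condition automatic.
  let X : Subshift D Γ := letterPreimage (fun d => (e d).2) S
  let X' : Subshift D Γ := interSubshift X (letterPreimage (fun d => (e d).1) Y)
  have hX'X : X'.carrier ⊆ X.carrier := Set.inter_subset_left
  have hfree : ∀ x ∈ X.carrier, pointStab x = ⊥ := fun x hx =>
    le_bot_iff.1 ((pointStab_le_comp (fun d => (e d).2) x).trans (hS _ hx).le)
  let f' : X'.carrier → Y.carrier := fun x => ⟨fun v => (e (x.1 v)).1, x.2.2⟩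
  have hf' : IsSubshiftMap X' Y f' := by
    refine ⟨Continuous.subtype_mk (continuous_pi fun v => ?_) _, fun v x => rfl⟩
    exact (continuous_of_discreteTopology (f := fun d => (e d).1)).comp
      ((continuous_apply v).comp continuous_subtype_val)
  obtain ⟨f, hf, hff'⟩ := hY D X X' hX'X (stabDominated_of_free hfree hYne) f' hf'
  obtain ⟨K₀, hK₀⟩ := exists_finite_window (X := X.carrier) X.isClosed.isCompact
    (f := fun x => (f x).1 0) ((continuous_apply 0).comp (continuous_subtype_val.comp hf.1))
  set K : Finset Γ := insert 0 K₀ with hK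
  have h0K : (0 : Γ) ∈ K := Finset.mem_insert_self _ _
  have hfK : ∀ x x' : X.carrier, (∀ w ∈ K, x.1 w = x'.1 w) → (f x).1 0 = (f x').1 0 :=
    fun x x' h => hK₀ x x' fun w hw => h w (Finset.mem_insert_of_mem hw)
  -- The rule must make sense on all configurations, since it is later applied outside `X`. The last
  -- branch is an arbitrary default for K-patterns that do not occur in `X`.
  let ρ : (Γ → D) → A := fun x =>
    if AdmissibleAt Y K (fun v => (e (x v)).1) 0 then (e (x 0)).1
    else if h : ∃ x' : X.carrier, ∀ w ∈ K, x'.1 w = x w then (f h.choose).1 0 else (e (x 0)).1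
  have hcopy : ∀ x, AdmissibleAt Y K (fun v => (e (x v)).1) 0 → ρ x = (e (x 0)).1 :=
    fun x h => if_pos h
  have hρK : ∀ x x', (∀ w ∈ K, x w = x' w) → ρ x = ρ x' := by
    intro x x' h
    have h1 : AdmissibleAt Y K (fun v => (e (x v)).1) 0
        ↔ AdmissibleAt Y K (fun v => (e (x' v)).1) 0 := by
      unfold AdmissibleAt
      refine exists_congr fun y => and_congr_right fun _ => forall₂_congr fun w hw => ?_
      simp only [zero_add, h w hw]
    have h2 : (∃ x₁ : X.carrier, ∀ w ∈ K, x₁.1 w = x w)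
        ↔ ∃ x₁ : X.carrier, ∀ w ∈ K, x₁.1 w = x' w :=
      exists_congr fun _ => forall₂_congr fun w hw => by rw [h w hw]
    by_cases c1 : AdmissibleAt Y K (fun v => (e (x v)).1) 0
    · rw [hcopy x c1, hcopy x' (h1.1 c1), h 0 h0K]
    · have c1' := fun h => c1 (h1.2 h)
      by_cases c2 : ∃ x₁ : X.carrier, ∀ w ∈ K, x₁.1 w = x w
      · simp only [ρ, if_neg c1, if_neg c1', dif_pos c2, dif_pos (h2.1 c2)]
        refine hfK _ _ fun w hw => ?_
        rw [c2.choose_spec w hw, (h2.1 c2).choose_spec w hw, h w hw]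
      · simp only [ρ, if_neg c1, if_neg c1', dif_neg c2, dif_neg fun h => c2 (h2.2 h), h 0 h0K]
  have hρf : ∀ x (hx : x ∈ X.carrier), ρ x = (f ⟨x, hx⟩).1 0 := by
    intro x hx
    by_cases c1 : AdmissibleAt Y K (fun v => (e (x v)).1) 0
    · rw [hcopy x c1]
      obtain ⟨y, hy, hyx⟩ := c1
      -- Replacing the first coordinate by `y` changes nothing on `K` and leads into `X'`, where `f`
      -- is the projection; so copying agrees with `f`.
      have hx'X : (fun v => e.symm (y v, (e (x v)).2)) ∈ X.carrier := by
        have : (fun d => (e d).2) ∘ (fun v => e.symm (y v, (e (x v)).2))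
            = (fun d => (e d).2) ∘ x := by ext v; simp
        change _ ∘ _ ∈ S.carrier
        rw [this]
        exact hx
      have hx' : (fun v => e.symm (y v, (e (x v)).2)) ∈ X'.carrier := by
        refine ⟨hx'X, ?_⟩
        have : (fun d => (e d).1) ∘ (fun v => e.symm (y v, (e (x v)).2)) = y := by ext v; simp
        change _ ∘ _ ∈ Y.carrier
        rwa [this]
      have h1 : (f ⟨x, hx⟩).1 0 = (f ⟨_, hX'X hx'⟩).1 0 := by
        refine hfK _ _ fun w hw => ?_
        have := hyx w hw
        simp only [zero_add] at this
        simp [this]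
      rw [h1, hff' _ hx']
      have := hyx 0 h0K
      simp only [add_zero] at this
      simp [f', this]
    · have c2 : ∃ x₁ : X.carrier, ∀ w ∈ K, x₁.1 w = x w := ⟨⟨x, hx⟩, fun _ _ => rfl⟩
      simp only [ρ, if_neg c1, dif_pos c2]
      exact hfK _ _ c2.choose_spec
  refine ⟨K, ρ, h0K, continuous_of_finite_window hρK, fun x hx => ?_, hcopy⟩
  rw [hf.eq_slidingMap X.mapsTo subset_rfl hρf hx]
  exact (f _).2

/-- Over an infinite group, every configuration with a sufficiently small group of periods can be
corrected to a point of `Y` with the same periods, without changing it where it is locally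
admissible. -/
theorem HasMapExtensionProperty.exists_gluing [Countable Γ] [Infinite Γ] [Finite A]
    (hY : HasMapExtensionProperty Y) (hYne : Y.carrier.Nonempty) :
    ∃ K V : Finset Γ, (0 : Γ) ∈ K ∧ ∀ Γ₀ : AddSubgroup Γ, AvoidsNonzero Γ₀ V →
      ∀ z : Γ → A, Γ₀ ≤ pointStab z →
        ∃ y ∈ fixedPart Y Γ₀, ∀ u, AdmissibleAt Y K z u → y u = z u := by
  classical
  obtain ⟨ν, hν⟩ := exists_injective_nat Γ
  obtain ⟨W, hW⟩ := exists_windows ν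
  obtain ⟨k, ⟨α⟩⟩ := Finite.exists_equiv_fin A
  obtain ⟨m, hm⟩ := markerSubshift_univ_nonempty hν hW
  -- Two marker coordinates: the first drives the local rule, the second only serves to make inputs
  -- free. The alphabet `A` is replaced by `Fin k` because the extension property concerns alphabets
  -- in `Type`.
  let C := Fin 10 × Fin 10
  let D := Fin k × C
  let e : D ≃ A × C := α.symm.prodCongr (Equiv.refl C)
  have hfin : ∀ n, {v | ν v < n}.Finite := fun n =>
    (Set.finite_lt_nat n).preimage hν.injOn
  have hfst : ∀ {E : Type} (h : E → Fin 10) (x : Γ → E) (W : Γ → Finset Γ),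
      h ∘ x ∈ (markerSubshift W Set.univ).carrier → pointStab x = ⊥ := fun h x W hx =>
    le_bot_iff.1 ((pointStab_le_comp h x).trans (pointStab_eq_bot_of_mem_markerSubshift hx).le)
  obtain ⟨K, ρ, h0K, hρ, hρY, hcopy⟩ := hY.exists_copying_rule hYne
    (letterPreimage (Prod.fst : C → Fin 10) (markerSubshift W Set.univ))
    (fun t ht => hfst Prod.fst t W ht) e
  -- Each `P n` imposes conditions for finitely many v only, so it can also contain Γ₀-periodic
  -- configurations when Γ₀ is small.
  let P : ℕ → Subshift D Γ := fun n =>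
    letterPreimage (fun d : D => d.2.1) (markerSubshift W {v | ν v < n})
  have hPall : ∀ x, (∀ n, x ∈ (P n).carrier) →
      (fun d : D => d.2.1) ∘ x ∈ (markerSubshift W Set.univ).carrier :=
    fun x hx v _ => hx (ν v + 1) v (Nat.lt_succ_self _)
  obtain ⟨n, hn⟩ := hY.exists_slidingMap_mem hYne P
    (fun a b hab x hx => markerSubshift_anti W (fun v hv => lt_of_lt_of_le hv hab) hx)
    (fun x hx => hfst _ x W (hPall x hx)) hρ (fun x hx => hρY x (hPall x hx))
  obtain ⟨V, hV⟩ := exists_periodic_marker hν hW (hfin n).toFinset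
  rw [Set.Finite.coe_toFinset] at hV
  refine ⟨K, V, h0K, fun Γ₀ hΓ z hz => ?_⟩
  obtain ⟨t, ht, htΓ⟩ := hV Γ₀ hΓ
  -- The constant second marker keeps Γ₀ among the periods. This input need not be free, so it is
  -- reached only as a limit of free ones.
  let x : Γ → D := fun v => (α (z v), t v, 0)
  have hxΓ : Γ₀ ≤ pointStab x := by
    intro v hv
    refine mem_pointStab.2 fun u => ?_
    simp only [x, mem_pointStab.1 (hz hv) u, mem_pointStab.1 (htΓ hv) u]
  have hxz : (fun v => (e (x v)).1) = z := funext fun v => α.symm_apply_apply (z v)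
  have hmem : slidingMap ρ x ∈ Y.carrier := by
    have hclosed : IsClosed {x | slidingMap ρ x ∈ Y.carrier} :=
      Y.isClosed.preimage (continuous_slidingMap hρ)
    refine hclosed.closure_subset (mem_closure_iff_nhds.2 fun U hU => ?_)
    obtain ⟨L, hL⟩ := exists_cylinder_subset hU
    obtain ⟨W', hW'⟩ := exists_windows_of_modify hm L 0
    let T : Subshift D Γ := interSubshift (P n)
      (letterPreimage (fun d : D => d.2.2) (markerSubshift W' Set.univ))
    -- It agrees with `x` on `L`, and its second marker is the aperiodic `m` changed on a finite
    -- set, which still breaks every period with the larger windows `W'`.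
    let x' : Γ → D := fun v => (α (z v), t v, if v ∈ L then 0 else m v)
    refine ⟨x', hL fun v hv => by simp [x', x, hv], ?_⟩
    exact hn T Set.inter_subset_left (fun y hy => hfst _ y W' hy.2) x' ⟨ht, hW'⟩
  refine ⟨slidingMap ρ x, ⟨hmem, hxΓ.trans (le_pointStab_slidingMap ρ x)⟩, fun u hu => ?_⟩
  have : ρ (shift u x) = (e (shift u x 0)).1 := by
    refine hcopy _ ?_
    obtain ⟨y, hy, hyz⟩ := hu
    refine ⟨shift u y, Y.mapsTo u hy, fun w hw => ?_⟩
    have := congrFun hxz (u + w)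
    simp only [shift_apply, zero_add, hyz w hw, ← this]
  rw [slidingMap, this, shift_apply, add_zero]
  exact α.symm_apply_apply (z u)

end Gluing

/-! ### Packing finite sets by pieces of translates -/

section Packing

variable {G : Type*} [AddCommGroup G]

/-- The points where a partial labelling is not constant on the window `p + K`. -/
def labelBoundary (K : Finset G) (c : G → Option G) : Set G :=
  {p | ∃ w ∈ K, c (p + w) ≠ c p}

/-- `c` labels points of `E`, a point of label `u` lying in the translate `u + F ⊆ E`. -/
def IsLabelling (F E : Finset G) (c : G → Option G) : Prop :=
  ∀ p u, c p = some u → (∃ f ∈ F, u + f = p) ∧ ∀ f ∈ F, u + f ∈ E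

theorem IsLabelling.mem {F E : Finset G} {c : G → Option G} (h : IsLabelling F E c) {p u : G}
    (hp : c p = some u) : p ∈ E := by
  obtain ⟨⟨f, hf, rfl⟩, hE⟩ := h p u hp
  exact hE f hf

open Pointwise in
theorem IsLabelling.finite_labelBoundary {K F E : Finset G} {c : G → Option G}
    (h : IsLabelling F E c) : (labelBoundary K c).Finite := by
  classical
  refine ((E ∪ (E - K)).finite_toSet).subset ?_
  rintro p ⟨w, hw, hne⟩
  rw [Finset.coe_union]
  cases hp : c p with
  | some u => exact Or.inl (h.mem hp)
  | none =>
    cases hpw : c (p + w) with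
    | some u => exact Or.inr (Finset.mem_coe.2 (Finset.mem_sub.2 ⟨_, h.mem hpw, w, hw, by abel⟩))
    | none => exact absurd (hpw.trans hp.symm) hne

variable [DecidableEq G]

/-- Enlarging a labelling by the unlabelled part of a translate of `F`. -/
theorem IsLabelling.exists_enlarge {K F E : Finset G} (hK : (0 : G) ∈ K) {c : G → Option G}
    (hc : IsLabelling F E c) {u : G} (hu : ∀ f ∈ F, u + f ∈ E) :
    ∃ c', IsLabelling F E c' ∧
      (E.filter (c' · ≠ none)).card
        = (E.filter (c · ≠ none)).card + (F.filter (fun f => c (u + f) = none)).card ∧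
      (labelBoundary K c').ncard ≤ (labelBoundary K c).ncard + (folnerBoundary K F).ncard := by
  let c' : G → Option G := fun p => if c p = none ∧ p - u ∈ F then some u else c p
  refine ⟨c', ?_, ?_, ?_⟩
  · intro p u' hp
    by_cases h : c p = none ∧ p - u ∈ F
    · simp only [c', if_pos h, Option.some.injEq] at hp
      subst hp
      exact ⟨⟨_, h.2, by abel⟩, hu⟩
    · simp only [c', if_neg h] at hp
      exact hc p u' hp
  · have : E.filter (c' · ≠ none)
        = E.filter (c · ≠ none) ∪ (F.filter (fun f => c (u + f) = none)).image (u + ·) := by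
      ext p
      simp only [Finset.mem_union, Finset.mem_filter, Finset.mem_image, c']
      constructor
      · rintro ⟨hp, hne⟩
        by_cases h : c p = none ∧ p - u ∈ F
        · exact Or.inr ⟨p - u, ⟨h.2, by simpa using h.1⟩, by abel⟩
        · rw [if_neg h] at hne
          exact Or.inl ⟨hp, hne⟩
      · rintro (⟨hp, hne⟩ | ⟨f, ⟨hf, hcf⟩, rfl⟩)
        · exact ⟨hp, by simp [hne]⟩
        · exact ⟨hu f hf, by simp [hcf, hf]⟩
    rw [this, Finset.card_union_of_disjoint, Finset.card_image_of_injective _ (add_right_injective u)]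
    rw [Finset.disjoint_left]
    intro p hp hp'
    obtain ⟨f, hf, rfl⟩ := Finset.mem_image.1 hp'
    exact (Finset.mem_filter.1 hp).2 (Finset.mem_filter.1 hf).2
  · have hsub : labelBoundary K c' ⊆ labelBoundary K c ∪ (u + ·) '' folnerBoundary K F := by
      rintro p ⟨w, hw, hne⟩
      by_contra hcon
      obtain ⟨h1, h2⟩ := not_or.1 hcon
      have hconst : c (p + w) = c p := by
        by_contra h; exact h1 ⟨w, hw, h⟩
      have hiff : p + w - u ∈ F ↔ p - u ∈ F := by
        by_contra h
        refine h2 ⟨p - u, ?_, by abel_nf⟩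
        have e1 : p - u + w = p + w - u := by abel
        by_cases hpF : p - u ∈ F
        · have hwF : p + w - u ∉ F := fun h' => h ⟨fun _ => hpF, fun _ => h'⟩
          exact ⟨⟨0, hK, by rwa [add_zero]⟩, w, hw, by rwa [e1]⟩
        · have hwF : p + w - u ∈ F := by
            by_contra h'; exact h ⟨fun h'' => absurd h'' h', fun h'' => absurd h'' hpF⟩
          exact ⟨⟨w, hw, by rwa [e1]⟩, 0, hK, by rwa [add_zero]⟩
      exact hne (by simp only [c', hconst, hiff])
    refine (Set.ncard_le_ncard hsub (hc.finite_labelBoundary.union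
      ((finite_folnerBoundary K F).image _))).trans ((Set.ncard_union_le _ _).trans ?_)
    exact Nat.add_le_add_left (Set.ncard_image_le (finite_folnerBoundary K F)) _

open Pointwise in
/-- If every translate of `F` inside `E` is mostly outside of `N ⊆ E`, then `N` is small. -/
theorem card_le_of_translates {F E N : Finset G} (hF : F.Nonempty) (hN : N ⊆ E) {ε : ℝ}
    (hε : 0 ≤ ε)
    (h : ∀ u, (∀ f ∈ F, u + f ∈ E) → ((F.filter (u + · ∈ N)).card : ℝ) ≤ ε * F.card) :
    (N.card : ℝ) ≤ ε * E.card + (folnerBoundary F E).ncard := by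
  have hFc : (0 : ℝ) < F.card := by exact_mod_cast hF.card_pos
  set T : Finset G := E - F with hT
  -- Double counting of pairs (u, f) with u + f in N. Translates contained in E contribute at most
  -- ε|F| each, and the others are indexed by boundary points of E.
  have hcount : ∑ u ∈ T, ((F.filter (u + · ∈ N)).card : ℝ) = F.card * N.card := by
    have h1 : ∑ u ∈ T, (F.filter (u + · ∈ N)).card = ∑ f ∈ F, (T.filter (· + f ∈ N)).card := by
      simp only [Finset.card_filter]
      exact Finset.sum_comm
    have h2 : ∀ f ∈ F, (T.filter (· + f ∈ N)).card = N.card := by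
      intro f hf
      refine Finset.card_bij (fun u _ => u + f) (fun u hu => (Finset.mem_filter.1 hu).2)
        (fun _ _ _ _ h => add_right_cancel h) fun p hp => ⟨p - f, ?_, by abel⟩
      exact Finset.mem_filter.2 ⟨Finset.sub_mem_sub (hN hp) hf, by simpa using hp⟩
    have h3 : ∑ u ∈ T, (F.filter (u + · ∈ N)).card = F.card * N.card := by
      rw [h1, Finset.sum_congr rfl h2, Finset.sum_const, smul_eq_mul]
    exact_mod_cast h3
  have hin : ((T.filter fun u => ∀ f ∈ F, u + f ∈ E).card : ℝ) ≤ E.card := by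
    obtain ⟨f, hf⟩ := hF
    refine Nat.cast_le.2 (Finset.card_le_card_of_injOn (· + f) (fun u hu => ?_)
      (fun _ _ _ _ h => add_right_cancel h))
    exact (Finset.mem_filter.1 (Finset.mem_coe.1 hu)).2 f hf
  have hout : ((T.filter fun u => ¬ ∀ f ∈ F, u + f ∈ E).card : ℝ)
      ≤ (folnerBoundary F E).ncard := by
    rw [← Set.ncard_coe_finset]
    refine Nat.cast_le.2 (Set.ncard_le_ncard ?_ (finite_folnerBoundary F E))
    intro u hu
    obtain ⟨hu1, hu2⟩ := Finset.mem_filter.1 hu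
    obtain ⟨p, hp, f, hf, rfl⟩ := Finset.mem_sub.1 hu1
    push Not at hu2
    exact ⟨⟨f, hf, by simpa using hp⟩, hu2⟩
  have h1 : ∑ u ∈ T, ((F.filter (u + · ∈ N)).card : ℝ)
      ≤ E.card * (ε * F.card) + (folnerBoundary F E).ncard * F.card := by
    rw [← Finset.sum_filter_add_sum_filter_not T (fun u => ∀ f ∈ F, u + f ∈ E)]
    refine add_le_add ?_ ?_
    · refine (Finset.sum_le_card_nsmul _ _ _ fun u hu => h u (Finset.mem_filter.1 hu).2).trans ?_
      rw [nsmul_eq_mul]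
      exact mul_le_mul_of_nonneg_right hin (by positivity)
    · refine (Finset.sum_le_card_nsmul _ _ (F.card : ℝ) fun u _ => ?_).trans ?_
      · exact_mod_cast Finset.card_filter_le _ _
      rw [nsmul_eq_mul]
      exact mul_le_mul_of_nonneg_right hout (by positivity)
  rw [hcount] at h1
  refine le_of_mul_le_mul_left ?_ hFc
  linarith

/-- Packing `E` by large pieces of translates of `F`, with few points near the boundaries of
the pieces. -/
theorem exists_packing {K F : Finset G} (hK : (0 : G) ∈ K) {ε : ℝ} (hε : 0 < ε)
    (hF : F.Nonempty) (hFK : ((folnerBoundary K F).ncard : ℝ) ≤ ε ^ 2 * F.card) (E : Finset G) :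
    ∃ (c : G → Option G) (Q : Finset G), IsLabelling F E c ∧
      (∀ p ∈ Q, p ∈ E ∧ c p ≠ none ∧ p ∉ labelBoundary K c) ∧
      (1 - 2 * ε) * E.card - (folnerBoundary F E).ncard ≤ (Q.card : ℝ) := by
  classical
  have hFc : (0 : ℝ) < F.card := by exact_mod_cast hF.card_pos
  -- Invariant of a greedy procedure: each step labels more than ε|F| new points and creates at most
  -- |∂_K F| new boundary points. It must stop, as at most |E| points can be labelled.
  let valid : (G → Option G) → Prop := fun c => IsLabelling F E c ∧
    ε * F.card * (labelBoundary K c).ncard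
      ≤ (folnerBoundary K F).ncard * ((E.filter (c · ≠ none)).card : ℝ)
  have hmax : ∃ c, valid c ∧ ∀ u, (∀ f ∈ F, u + f ∈ E) →
      ((F.filter (fun f => c (u + f) = none)).card : ℝ) ≤ ε * F.card := by
    by_contra! hcon
    have hgrow : ∀ n : ℕ, ∃ c, valid c ∧ n ≤ (E.filter (c · ≠ none)).card := by
      intro n
      induction n with
      | zero =>
        refine ⟨fun _ => none, ⟨fun p u h => by simp at h, ?_⟩, Nat.zero_le _⟩
        have : labelBoundary K (fun _ : G => (none : Option G)) = ∅ :=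
          Set.eq_empty_of_forall_notMem fun p ⟨w, _, h⟩ => h rfl
        rw [this, Set.ncard_empty, Nat.cast_zero, mul_zero]
        positivity
      | succ n ih =>
        obtain ⟨c, hc, hn⟩ := ih
        obtain ⟨u, hu, hlt⟩ := hcon c hc
        obtain ⟨c', hc', hcard, hbd⟩ := hc.1.exists_enlarge hK hu
        refine ⟨c', ⟨hc', ?_⟩, ?_⟩
        · have h1 : ((labelBoundary K c').ncard : ℝ)
              ≤ (labelBoundary K c).ncard + (folnerBoundary K F).ncard := by exact_mod_cast hbd
          have h2 := mul_le_mul_of_nonneg_left h1 (mul_pos hε hFc).le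
          have h3 := mul_le_mul_of_nonneg_left hlt.le
            (Nat.cast_nonneg (α := ℝ) (folnerBoundary K F).ncard)
          have h4 := hc.2
          rw [hcard]
          push_cast
          linarith
        · have : 0 < (F.filter (fun f => c (u + f) = none)).card := by
            have := (mul_pos hε hFc).trans hlt
            exact_mod_cast this
          omega
    obtain ⟨c, -, hc⟩ := hgrow (E.card + 1)
    have := Finset.card_filter_le E (c · ≠ none)
    omega
  obtain ⟨c, ⟨hc, hbd⟩, hfull⟩ := hmax
  refine ⟨c, E.filter fun p => c p ≠ none ∧ p ∉ labelBoundary K c, hc,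
    fun p hp => Finset.mem_filter.1 hp, ?_⟩
  have hN := card_le_of_translates (N := E.filter (c · = none)) hF (Finset.filter_subset _ _) hε.le
    (fun u hu => by
      refine le_trans ?_ (hfull u hu)
      refine Nat.cast_le.2 (Finset.card_le_card fun f hf => ?_)
      obtain ⟨h1, h2⟩ := Finset.mem_filter.1 hf
      exact Finset.mem_filter.2 ⟨h1, (Finset.mem_filter.1 h2).2⟩)
  have hB : ((labelBoundary K c).ncard : ℝ) ≤ ε * E.card := by
    have h1 : ((E.filter (c · ≠ none)).card : ℝ) ≤ E.card := by
      exact_mod_cast Finset.card_filter_le _ _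
    have h2 := mul_le_mul hFK h1 (Nat.cast_nonneg _) (by positivity)
    refine le_of_mul_le_mul_left ?_ (mul_pos hε hFc)
    nlinarith [hbd.trans h2]
  have hsplit : E.card ≤ (E.filter fun p => c p ≠ none ∧ p ∉ labelBoundary K c).card
      + (E.filter (c · = none)).card + (labelBoundary K c).ncard := by
    rw [Set.ncard_eq_toFinset_card _ hc.finite_labelBoundary]
    refine (Finset.card_le_card ?_).trans ((Finset.card_union_le _ _).trans
      (Nat.add_le_add_right (Finset.card_union_le _ _) _))
    intro p hp
    simp only [Finset.mem_union, Finset.mem_filter, Set.Finite.mem_toFinset, hp, true_and]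
    tauto
  have hsplit' : (E.card : ℝ) ≤ (E.filter fun p => c p ≠ none ∧ p ∉ labelBoundary K c).card
      + (E.filter (c · = none)).card + (labelBoundary K c).ncard := by exact_mod_cast hsplit
  linarith

end Packing

/-! ### Counting glued configurations -/

section Counting

variable {Γ : Type*} [AddCommGroup Γ] {A : Type*} [TopologicalSpace A]

/-- The points of the quotient of `Y_{[Γ₀]}` that agree with `z₀` at the locally admissible places
away from `E`. -/
def agreeingPart (Y : Subshift A Γ) (Γ₀ : AddSubgroup Γ) (K : Finset Γ) (E : Finset (Γ ⧸ Γ₀))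
    (z₀ : Γ ⧸ Γ₀ → A) : Set (Γ ⧸ Γ₀ → A) :=
  {y ∈ quotientImage Γ₀ (fixedPart Y Γ₀) | ∀ p : Γ, (∀ w ∈ K, ((p + w : Γ) : Γ ⧸ Γ₀) ∉ E) →
    AdmissibleAt Y K (fun v => z₀ v) p → y p = z₀ p}

/-- The gluing property of `Y` for the group of periods `Γ₀` and the window `K`. -/
def GluesAt (Y : Subshift A Γ) (Γ₀ : AddSubgroup Γ) (K : Finset Γ) : Prop :=
  ∀ z : Γ → A, Γ₀ ≤ pointStab z →
    ∃ y ∈ fixedPart Y Γ₀, ∀ u, AdmissibleAt Y K z u → y u = z u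

theorem folnerBoundary_image_mk_subset [DecidableEq Γ] (Γ₀ : AddSubgroup Γ)
    [DecidableEq (Γ ⧸ Γ₀)] (K F : Finset Γ) :
    folnerBoundary (K.image (QuotientAddGroup.mk : Γ → Γ ⧸ Γ₀)) (F.image QuotientAddGroup.mk)
      ⊆ QuotientAddGroup.mk '' folnerBoundary K F := by
  rintro g ⟨⟨k, hk, hkF⟩, k', hk', hkF'⟩
  obtain ⟨w, hw, rfl⟩ := Finset.mem_image.1 hk
  obtain ⟨w', hw', rfl⟩ := Finset.mem_image.1 hk'
  obtain ⟨f, hf, hfg⟩ := Finset.mem_image.1 hkF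
  have hg : ((f - w : Γ) : Γ ⧸ Γ₀) = g := by
    rw [QuotientAddGroup.mk_sub, hfg, add_sub_cancel_right]
  refine ⟨f - w, ⟨⟨w, hw, by simpa using hf⟩, w', hw', fun h => hkF' ?_⟩, hg⟩
  exact Finset.mem_image.2 ⟨_, h, by rw [QuotientAddGroup.mk_add, hg]⟩

open Pointwise in
/-- Independent choices of points of `Y` on the pieces of a packing can be glued. -/
theorem GluesAt.exists_glued [DecidableEq Γ] {Y : Subshift A Γ} {Γ₀ : AddSubgroup Γ}
    [DecidableEq (Γ ⧸ Γ₀)] {K F : Finset Γ} (hglue : GluesAt Y Γ₀ K) (hK : (0 : Γ) ∈ K)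
    (hΓ : AvoidsNonzero Γ₀ (F - F - K)) {E : Finset (Γ ⧸ Γ₀)} {c : Γ ⧸ Γ₀ → Option (Γ ⧸ Γ₀)}
    (hc : IsLabelling (F.image QuotientAddGroup.mk) E c) (z₀ : Γ ⧸ Γ₀ → A) :
    ∃ l : Γ ⧸ Γ₀ → Γ, (∀ p, c p ≠ none → (l p : Γ ⧸ Γ₀) = p) ∧
      ∀ y : Γ ⧸ Γ₀ → Γ → A, (∀ u, y u ∈ Y.carrier) → ∃ x ∈ agreeingPart Y Γ₀ K E z₀,
        ∀ p u, c p = some u → p ∉ labelBoundary (K.image QuotientAddGroup.mk) c →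
          x p = y u (l p) := by
  have hlift : ∀ p : Γ ⧸ Γ₀, ∃ l : Γ, ∀ u, c p = some u →
      (l : Γ ⧸ Γ₀) = p ∧ l - u.out ∈ F := by
    intro p
    cases hp : c p with
    | none => exact ⟨0, fun u h => by simp at h⟩
    | some u =>
      obtain ⟨⟨g, hg, hgp⟩, -⟩ := hc p u hp
      obtain ⟨f, hf, rfl⟩ := Finset.mem_image.1 hg
      refine ⟨u.out + f, fun u' hu' => ?_⟩
      obtain rfl : u = u' := by simpa using hu'
      refine ⟨?_, by simpa using hf⟩
      rw [QuotientAddGroup.mk_add, QuotientAddGroup.out_eq', hgp]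
  choose l hl using hlift
  refine ⟨l, fun p hp => ?_, fun y hy => ?_⟩
  · obtain ⟨u, hu⟩ := Option.ne_none_iff_exists'.1 hp
    exact (hl p u hu).1
  -- Each piece carries its own point of Y, read in the lift of the piece to Γ. Outside `E` there
  -- are no labels, so `z` equals `z₀` there.
  let z : Γ ⧸ Γ₀ → A := fun p => (c p).elim (z₀ p) fun u => y u (l p)
  have hz : ∀ p u, c p = some u → z p = y u (l p) := fun p u h => by simp [z, h]
  have hz' : ∀ p, p ∉ E → z p = z₀ p := by
    intro p hp
    have : c p = none := by
      by_contra h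
      obtain ⟨u, hu⟩ := Option.ne_none_iff_exists'.1 h
      exact hp (hc.mem hu)
    simp [z, this]
  obtain ⟨x, hx, hxz⟩ := hglue (fun v => z v) (le_pointStab_iff_exists.2 ⟨z, fun _ => rfl⟩)
  obtain ⟨x', hx'⟩ := le_pointStab_iff_exists.1 hx.2
  refine ⟨x', ⟨⟨x, hx, hx'⟩, fun p hp hadm => ?_⟩, fun p u hpu hpb => ?_⟩
  · rw [← hx', hxz p, hz' _ (by simpa using hp 0 hK)]
    obtain ⟨y₀, hy₀, h⟩ := hadm
    exact ⟨y₀, hy₀, fun w hw => (h w hw).trans (hz' _ (hp w hw)).symm⟩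
  · obtain ⟨hlp, hlF⟩ := hl p u hpu
    have hconst : ∀ w ∈ K, z ((l p + w : Γ) : Γ ⧸ Γ₀) = y u (l p + w) := by
      intro w hw
      have hcw : c (p + (w : Γ ⧸ Γ₀)) = some u := by
        rw [← hpu]
        by_contra h
        exact hpb ⟨_, Finset.mem_image_of_mem _ hw, h⟩
      obtain ⟨h1, h2⟩ := hl _ u hcw
      rw [QuotientAddGroup.mk_add, hlp, hz _ u hcw]
      congr 1
      -- The lifts of points with a common label share the base point `u.out`, so the discrepancy
      -- lies in F - F - K as well as in Γ₀, and hence vanishes.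
      have h3 := hΓ _ (Finset.sub_mem_sub (Finset.sub_mem_sub h2 hlF) hw) (by
        rw [← QuotientAddGroup.eq_zero_iff]
        simp only [QuotientAddGroup.mk_sub, h1, hlp]
        abel)
      have h4 : l (p + (w : Γ ⧸ Γ₀)) - (l p + w) = 0 := by rw [← h3]; abel
      exact sub_eq_zero.1 h4
    have h0 := hconst 0 hK
    rw [add_zero, hlp] at h0
    have h1 : x (l p) = z (l p : Γ ⧸ Γ₀) := hxz _ ⟨y u, hy u, fun w hw => (hconst w hw).symm⟩
    rw [hx', hlp] at h1
    rw [h1, h0]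

-- Patterns of Y on the lifted interior points of the different pieces are chosen independently, and
-- the glued point determines them all. These sets have no controlled shape, so it matters that `h`
-- bounds the normalised count of every finite set from below.
open Pointwise in
theorem GluesAt.mul_le_log_ncard_admissible [Finite A] [DecidableEq Γ] {Y : Subshift A Γ}
    {Γ₀ : AddSubgroup Γ}
    [DecidableEq (Γ ⧸ Γ₀)] {K F : Finset Γ} (hglue : GluesAt Y Γ₀ K) (hK : (0 : Γ) ∈ K)
    (hΓ : AvoidsNonzero Γ₀ (F - F - K)) {h : ℝ}
    (h0 : 0 ≤ h) (hh : ∀ F : Finset Γ, h * F.card ≤ Real.log ((admissible Y.carrier F).ncard : ℝ))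
    (hYne : Y.carrier.Nonempty)
    {E : Finset (Γ ⧸ Γ₀)} {c : Γ ⧸ Γ₀ → Option (Γ ⧸ Γ₀)}
    (hc : IsLabelling (F.image QuotientAddGroup.mk) E c) (z₀ : Γ ⧸ Γ₀ → A) (Q : Finset (Γ ⧸ Γ₀))
    (hQ : ∀ p ∈ Q, p ∈ E ∧ c p ≠ none ∧ p ∉ labelBoundary (K.image QuotientAddGroup.mk) c) :
    h * Q.card ≤ Real.log ((admissible (agreeingPart Y Γ₀ K E z₀) E).ncard : ℝ) := by
  obtain ⟨l, hl, hglued⟩ := hglue.exists_glued hK hΓ hc z₀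
  let U : Finset (Γ ⧸ Γ₀) := Q.biUnion fun p => (c p).toFinset
  have hU : ∀ p ∈ Q, ∃ u ∈ U, c p = some u := by
    intro p hp
    obtain ⟨u, hu⟩ := Option.ne_none_iff_exists'.1 (hQ p hp).2.1
    exact ⟨u, Finset.mem_biUnion.2 ⟨p, hp, by simp [hu]⟩, hu⟩
  let Qu : Γ ⧸ Γ₀ → Finset (Γ ⧸ Γ₀) := fun u => Q.filter (c · = some u)
  let R : Γ ⧸ Γ₀ → Finset Γ := fun u => (Qu u).image l
  have hR : ∀ u, (R u).card = (Qu u).card := fun u =>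
    Finset.card_image_of_injOn fun p hp q hq hpq => by
      rw [← hl p (hQ p (Finset.mem_filter.1 hp).1).2.1,
        ← hl q (hQ q (Finset.mem_filter.1 hq).1).2.1, hpq]
  have hQsum : (Q.card : ℝ) ≤ ∑ u : U, ((R u).card : ℝ) := by
    simp only [hR]
    rw [Finset.sum_coe_sort U fun u => ((Qu u).card : ℝ)]
    have h1 : Q ⊆ U.biUnion Qu := fun p hp => by
      obtain ⟨u, hu, hpu⟩ := hU p hp
      exact Finset.mem_biUnion.2 ⟨u, hu, Finset.mem_filter.2 ⟨hp, hpu⟩⟩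
    exact_mod_cast (Finset.card_le_card h1).trans Finset.card_biUnion_le
  have hchoice : ∀ θ : (u : U) → admissible Y.carrier (R u), ∃ x ∈ agreeingPart Y Γ₀ K E z₀,
      ∀ p ∈ Q, ∀ (u : U) (_ : c p = some (u : Γ ⧸ Γ₀)) (hlp : l p ∈ R u),
        x p = (θ u).1 ⟨l p, hlp⟩ := by
    intro θ
    choose y hy hyθ using fun u : U => (θ u).2
    obtain ⟨y₀, hy₀⟩ := hYne
    obtain ⟨x, hx, hxp⟩ := hglued (fun u => if hu : u ∈ U then y ⟨u, hu⟩ else y₀) (fun u => by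
      by_cases hu : u ∈ U
      · simpa only [dif_pos hu] using hy ⟨u, hu⟩
      · simpa only [dif_neg hu] using hy₀)
    refine ⟨x, hx, fun p hp u hpu hlp => ?_⟩
    rw [hxp p u hpu (hQ p hp).2.2, dif_pos u.2, ← hyθ u]
  choose x hx hxθ using hchoice
  let Ψ : ((u : U) → admissible Y.carrier (R u)) → admissible (agreeingPart Y Γ₀ K E z₀) E :=
    fun θ => ⟨fun v => x θ v, x θ, hx θ, rfl⟩
  have hΨ : Function.Injective Ψ := by
    intro θ θ' heq
    ext u ⟨r, hr⟩
    obtain ⟨p, hp, rfl⟩ := Finset.mem_image.1 hr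
    obtain ⟨hpQ, hpu⟩ := Finset.mem_filter.1 hp
    rw [← hxθ θ p hpQ u hpu hr, ← hxθ θ' p hpQ u hpu hr]
    exact congrFun (congrArg Subtype.val heq) ⟨p, (hQ p hpQ).1⟩
  have hcard := Nat.card_le_card_of_injective Ψ hΨ
  rw [Nat.card_pi] at hcard
  simp only [Nat.card_coe_set_eq] at hcard
  have hpos : ∀ u : U, (0 : ℝ) < (admissible Y.carrier (R u)).ncard := fun u => by
    exact_mod_cast ncard_admissible_pos hYne (R u)
  calc h * Q.card ≤ h * ∑ u : U, ((R u).card : ℝ) := mul_le_mul_of_nonneg_left hQsum h0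
    _ = ∑ u : U, h * ((R u).card : ℝ) := Finset.mul_sum _ _ _
    _ ≤ ∑ u : U, Real.log (admissible Y.carrier (R u)).ncard :=
      Finset.sum_le_sum fun u _ => hh (R u)
    _ = Real.log (∏ u : U, ((admissible Y.carrier (R u)).ncard : ℝ)) :=
      (Real.log_prod fun u _ => (hpos u).ne').symm
    _ ≤ _ := Real.log_le_log (Finset.prod_pos fun u _ => hpos u) (by exact_mod_cast hcard)

end Counting

/-! ### Lower bounds for the entropy of periodic parts -/

section LowerBound

variable {Γ : Type*} [AddCommGroup Γ] {A : Type*} [Finite A] [TopologicalSpace A]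
  {Y : Subshift A Γ}

-- `F` and `V'` are chosen before Γ₀, `E` and `z₀`. The uniformity allows `E` to be a Følner set of
-- the quotient or the complement of a fixed pattern in a finite quotient.
open Pointwise in
theorem exists_forall_le_log_ncard_agreeingPart [DecidableEq Γ] (hYne : Y.carrier.Nonempty)
    {K V : Finset Γ} (hK : (0 : Γ) ∈ K)
    (hglue : ∀ Γ₀ : AddSubgroup Γ, AvoidsNonzero Γ₀ V → GluesAt Y Γ₀ K) {h : ℝ} (h0 : 0 ≤ h)
    (hh : ∀ F : Finset Γ, h * F.card ≤ Real.log ((admissible Y.carrier F).ncard : ℝ))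
    {ε : ℝ} (hε : 0 < ε) :
    ∃ F V' : Finset Γ, ∀ Γ₀ : AddSubgroup Γ, AvoidsNonzero Γ₀ V' →
      ∀ [DecidableEq (Γ ⧸ Γ₀)] (E : Finset (Γ ⧸ Γ₀)) (z₀ : Γ ⧸ Γ₀ → A),
        h * ((1 - 2 * ε) * E.card -
            (folnerBoundary (F.image (QuotientAddGroup.mk : Γ → Γ ⧸ Γ₀)) E).ncard)
          ≤ Real.log ((admissible (agreeingPart Y Γ₀ K E z₀) E).ncard : ℝ) := by
  obtain ⟨F, hF⟩ := exists_isFolnerInvariant K (pow_pos hε 2)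
  refine ⟨F, V ∪ (F - F - K) ∪ (F - F), fun Γ₀ hΓ _ E z₀ => ?_⟩
  have hΓ1 : AvoidsNonzero Γ₀ V :=
    hΓ.mono (Finset.subset_union_left.trans Finset.subset_union_left)
  have hΓ2 : AvoidsNonzero Γ₀ (F - F - K) :=
    hΓ.mono (Finset.subset_union_right.trans Finset.subset_union_left)
  have hΓ3 : AvoidsNonzero Γ₀ (F - F) := hΓ.mono Finset.subset_union_right
  have h0K : (0 : Γ ⧸ Γ₀) ∈ K.image (QuotientAddGroup.mk : Γ → Γ ⧸ Γ₀) :=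
    Finset.mem_image.2 ⟨0, hK, rfl⟩
  obtain ⟨c, Q, hc, hQ, hcard⟩ := exists_packing h0K hε
    (hF.nonempty.image (QuotientAddGroup.mk : Γ → Γ ⧸ Γ₀)) (by
      rw [Finset.card_image_of_injOn hΓ3.injOn_mk]
      refine le_trans ?_ hF.le
      exact_mod_cast (Set.ncard_le_ncard (folnerBoundary_image_mk_subset Γ₀ K F)
        ((finite_folnerBoundary K F).image _)).trans
        (Set.ncard_image_le (finite_folnerBoundary K F))) E
  exact (mul_le_mul_of_nonneg_left hcard h0).trans
    ((hglue Γ₀ hΓ1).mul_le_log_ncard_admissible hK hΓ2 h0 hh hYne hc z₀ Q hQ)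

theorem eventually_lt_entropy_fixedPart [DiscreteTopology A] [Countable Γ] [Infinite Γ]
    (hY : HasMapExtensionProperty Y) {c : EReal} (hc : c < entropy Y.carrier) :
    ∀ᶠ Γ₀ in 𝓝 (⊥ : AddSubgroup Γ), c < entropy (quotientImage Γ₀ (fixedPart Y Γ₀)) := by
  classical
  rcases Y.carrier.eq_empty_or_nonempty with hem | hYne
  · simp [hem, entropy_empty] at hc
  obtain ⟨K, V, hK, hglue⟩ := hY.exists_gluing hYne
  obtain ⟨h, h0, hent, hh⟩ := exists_entropy_eq hYne Y.mapsTo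
  rw [hent] at hc
  obtain ⟨r, hcr, hrh⟩ := EReal.lt_iff_exists_real_btwn.1 hc
  rw [EReal.coe_lt_coe_iff] at hrh
  -- The packing loses 2ε and the boundary of `E` one more ε; h + 1 rather than h because h may
  -- vanish.
  set ε : ℝ := (h - r) / (3 * (h + 1)) with hε
  have hεpos : 0 < ε := div_pos (by linarith) (by linarith)
  have hεh : h * (3 * ε) ≤ h - r := by
    have : h * (3 * ε) = (h - r) * (h / (h + 1)) := by
      rw [hε]; field_simp
    rw [this]
    exact mul_le_of_le_one_right (by linarith) ((div_le_one (by linarith)).2 (by linarith))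
  obtain ⟨F, V', hcount⟩ :=
    exists_forall_le_log_ncard_agreeingPart hYne hK hglue h0 hh hεpos
  filter_upwards [eventually_avoidsNonzero V, eventually_avoidsNonzero V'] with Γ₀ hΓ hΓ'
  obtain ⟨a, -⟩ : ∃ a : A, True := ⟨hYne.some 0, trivial⟩
  have hne : (quotientImage Γ₀ (fixedPart Y Γ₀)).Nonempty := by
    obtain ⟨y, hy, -⟩ := hglue Γ₀ hΓ (fun _ => a) fun v _ => mem_pointStab.2 fun _ => rfl
    obtain ⟨z, hz⟩ := le_pointStab_iff_exists.1 hy.2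
    exact ⟨z, y, hy, hz⟩
  refine hcr.trans_le (le_entropy hne ?_)
  filter_upwards [eventually_isFolnerInvariant (F.image QuotientAddGroup.mk) hεpos] with E hE
  have hEc : (0 : ℝ) < E.card := by exact_mod_cast hE.nonempty.card_pos
  rw [le_div_iff₀ hEc]
  have h1 := hcount Γ₀ hΓ' E fun _ => a
  have h2 : (admissible (agreeingPart Y Γ₀ K E fun _ => a) E).ncard
      ≤ (admissible (quotientImage Γ₀ (fixedPart Y Γ₀)) E).ncard :=
    ncard_admissible_mono (Set.sep_subset _ _) E
  have hlog : Real.log (admissible (agreeingPart Y Γ₀ K E fun _ => a) E).ncard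
      ≤ Real.log (admissible (quotientImage Γ₀ (fixedPart Y Γ₀)) E).ncard := by
    rcases Nat.eq_zero_or_pos (admissible (agreeingPart Y Γ₀ K E fun _ => a) E).ncard with h3 | h3
    · rw [h3, Nat.cast_zero, Real.log_zero]
      exact Real.log_natCast_nonneg _
    · exact Real.log_le_log (by exact_mod_cast h3) (by exact_mod_cast h2)
  refine le_trans ?_ (h1.trans hlog)
  have h4 : (1 - 3 * ε) * E.card ≤ (1 - 2 * ε) * E.card -
      (folnerBoundary (F.image (QuotientAddGroup.mk : Γ → Γ ⧸ Γ₀)) E).ncard := by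
    unfold IsFolnerInvariant at hE
    linarith
  refine le_trans ?_ (mul_le_mul_of_nonneg_left h4 h0)
  rw [← mul_assoc]
  exact mul_le_mul_of_nonneg_right (by linarith) hEc.le

/-! ### Configurations with trivial kernel -/

-- If y v = y 0 held throughout Y, applying it to all shifts of y would make v a period of every
-- point.
omit [Finite A] in
theorem exists_ne_of_subshiftKer_eq_bot (hker : subshiftKer Y = ⊥) {v : Γ} (hv : v ≠ 0) :
    ∃ y ∈ Y.carrier, y v ≠ y 0 := by
  by_contra! hcon
  refine hv (AddSubgroup.mem_bot.1 (hker ▸ ?_))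
  refine AddSubgroup.mem_iInf.2 fun x => AddSubgroup.mem_iInf.2 fun hx =>
    mem_pointStab.2 fun u => ?_
  have := hcon (shift u x) (Y.mapsTo u hx)
  simpa [add_comm] using this

/-- A subset of `E` that is separated with respect to `S` and maximal with this property. -/
theorem exists_maximal_separated {G : Type*} [AddCommGroup G] [DecidableEq G] (S E : Finset G)
    (hS : (0 : G) ∈ S) (hneg : ∀ s ∈ S, -s ∈ S) :
    ∃ D ⊆ E, (∀ d ∈ D, ∀ d' ∈ D, d - d' ∈ S → d = d') ∧ E.card ≤ D.card * S.card := by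
  let P : Finset (Finset G) :=
    E.powerset.filter fun D => ∀ d ∈ D, ∀ d' ∈ D, d - d' ∈ S → d = d'
  obtain ⟨D, hD, hmax⟩ := P.exists_max_image Finset.card ⟨∅, by simp [P]⟩
  obtain ⟨hDE, hsep⟩ := Finset.mem_filter.1 hD
  rw [Finset.mem_powerset] at hDE
  refine ⟨D, hDE, hsep, ?_⟩
  have hcover : E ⊆ (D ×ˢ S).image fun p => p.1 + p.2 := by
    intro e he
    by_contra hne
    have hfar : ∀ d ∈ D, e - d ∉ S := fun d hd hs =>
      hne (Finset.mem_image.2 ⟨(d, e - d), Finset.mem_product.2 ⟨hd, hs⟩, by simp⟩)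
    have heD : e ∉ D := fun h => hfar e h (by simpa using hS)
    have hins : insert e D ∈ P := by
      refine Finset.mem_filter.2 ⟨Finset.mem_powerset.2 (Finset.insert_subset he hDE), ?_⟩
      intro d hd d' hd' hdd
      rcases Finset.mem_insert.1 hd with rfl | hdD
      · rcases Finset.mem_insert.1 hd' with rfl | hdD'
        · rfl
        · exact absurd hdd (hfar d' hdD')
      · rcases Finset.mem_insert.1 hd' with rfl | hdD'
        · exact absurd (by simpa using hneg _ hdd) (hfar d hdD)
        · exact hsep d hdD d' hdD' hdd
    have := hmax _ hins
    rw [Finset.card_insert_of_notMem heD] at this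
    omega
  refine (Finset.card_le_card hcover).trans (Finset.card_image_le.trans ?_)
  rw [Finset.card_product]

open Pointwise in
/-- A subshift with the gluing property and two distinct letters has positive entropy. -/
theorem entropy_pos_of_gluesAt [DecidableEq Γ] {K : Finset Γ} (hK : (0 : Γ) ∈ K)
    (hglue : GluesAt Y ⊥ K) {y : Γ → A} (hy : y ∈ Y.carrier) {v : Γ} (hv : y v ≠ y 0) :
    0 < entropy Y.carrier := by
  classical
  -- Points separated by K - K have disjoint K-windows, so the patterns of `y` around 0 and around
  -- `v` can be placed at them independently. A maximal separated set has density at least 1/|S|.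
  set S : Finset Γ := K - K with hS
  have hS0 : (0 : Γ) ∈ S := Finset.mem_sub.2 ⟨0, hK, 0, hK, sub_zero 0⟩
  have hSneg : ∀ s ∈ S, -s ∈ S := by
    intro s hs
    obtain ⟨a, ha, b, hb, rfl⟩ := Finset.mem_sub.1 hs
    exact Finset.mem_sub.2 ⟨b, hb, a, ha, by abel⟩
  have hSc : (0 : ℝ) < S.card := by exact_mod_cast Finset.card_pos.2 ⟨0, hS0⟩
  have hlog2 : 0 < Real.log 2 / S.card := div_pos (Real.log_pos one_lt_two) hSc
  refine lt_of_lt_of_le (EReal.coe_pos.2 hlog2) (le_entropy ⟨y, hy⟩ ?_)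
  filter_upwards [eventually_folnerFilter_nonempty] with E hE
  obtain ⟨D, hDE, hsep, hcard⟩ := exists_maximal_separated S E hS0 hSneg
  have hchoice : ∀ δ : Finset Γ, ∃ x ∈ Y.carrier, ∀ d ∈ D, x d = if d ∈ δ then y 0 else y v := by
    intro δ
    let z : Γ → A := fun p => if h : ∃ d ∈ D, p - d ∈ K then
      (if h.choose ∈ δ then y (p - h.choose) else y (v + (p - h.choose))) else y 0
    have hz : ∀ d ∈ D, ∀ w ∈ K, z (d + w) = if d ∈ δ then y w else y (v + w) := by
      intro d hd w hw
      have h : ∃ d' ∈ D, d + w - d' ∈ K := ⟨d, hd, by simpa using hw⟩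
      have hd' : h.choose = d := hsep _ h.choose_spec.1 _ hd
        (Finset.mem_sub.2 ⟨w, hw, _, h.choose_spec.2, by abel⟩)
      simp only [z, dif_pos h, hd', add_sub_cancel_left]
    obtain ⟨x, hx, hxz⟩ := hglue z bot_le
    refine ⟨x, hx.1, fun d hd => ?_⟩
    rw [hxz d]
    · simpa using hz d hd 0 hK
    · by_cases hdδ : d ∈ δ
      · refine ⟨shift (-d) y, Y.mapsTo _ hy, fun w hw => ?_⟩
        rw [hz d hd w hw, if_pos hdδ]
        simp
      · refine ⟨shift (v - d) y, Y.mapsTo _ hy, fun w hw => ?_⟩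
        rw [hz d hd w hw, if_neg hdδ, shift_apply]
        congr 1
        abel
  choose x hx hxD using hchoice
  have hpow : 2 ^ D.card ≤ (admissible Y.carrier E).ncard := by
    rw [← Finset.card_powerset, ← Set.ncard_coe_finset]
    refine Set.ncard_le_ncard_of_injOn (fun δ (v : E) => x δ v) (fun δ _ => ⟨x δ, hx δ, rfl⟩) ?_
      (Set.toFinite _)
    intro δ hδ δ' hδ' heq
    have hmem : ∀ d ∈ D, d ∈ δ ↔ d ∈ δ' := by
      intro d hd
      have h1 : x δ d = x δ' d := congrFun heq ⟨d, hDE hd⟩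
      rw [hxD δ d hd, hxD δ' d hd] at h1
      by_cases a : d ∈ δ <;> by_cases b : d ∈ δ' <;> simp [a, b, hv, hv.symm] at h1 ⊢
    have hδD := Finset.mem_powerset.1 (Finset.mem_coe.1 hδ)
    have hδD' := Finset.mem_powerset.1 (Finset.mem_coe.1 hδ')
    ext d
    exact ⟨fun h => (hmem d (hδD h)).1 h, fun h => (hmem d (hδD' h)).2 h⟩
  have hEc : (0 : ℝ) < E.card := by exact_mod_cast hE.card_pos
  rw [div_le_div_iff₀ hSc hEc]
  have h1 : (D.card : ℝ) * Real.log 2 ≤ Real.log (admissible Y.carrier E).ncard := by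
    rw [← Real.log_pow]
    exact Real.log_le_log (by positivity) (by exact_mod_cast hpow)
  have h2 : (E.card : ℝ) ≤ D.card * S.card := by exact_mod_cast hcard
  have h3 := mul_le_mul_of_nonneg_left h2 (Real.log_pos one_lt_two).le
  have h4 := mul_le_mul_of_nonneg_right h1 hSc.le
  linarith

omit [Finite A] in
open Pointwise in
/-- A finite configuration that excludes all nonzero elements of `V` as periods. -/
theorem exists_period_breaking [Infinite Γ] [DecidableEq Γ] (hYne : Y.carrier.Nonempty)
    (hker : subshiftKer Y = ⊥) (K : Finset Γ) (hK : (0 : Γ) ∈ K) (V : Finset Γ) :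
    ∃ (Z : Finset Γ) (ζ : Γ → A), ∀ v ∈ V, v ≠ 0 → ∃ p,
      (∀ w ∈ K, p + w ∈ Z ∧ p + v + w ∈ Z) ∧ ζ (p + v) ≠ ζ p ∧
        AdmissibleAt Y K ζ p ∧ AdmissibleAt Y K ζ (p + v) := by
  induction V using Finset.induction_on with
  | empty => exact ⟨∅, fun _ => hYne.some 0, by simp⟩
  | insert v V _ ih =>
    obtain ⟨Z, ζ, hζ⟩ := ih
    by_cases hv : v = 0
    · refine ⟨Z, ζ, fun v' hv' hne => hζ v' ?_ hne⟩
      exact (Finset.mem_insert.1 hv').resolve_left fun h => hne (h.trans hv)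
    obtain ⟨y, hy, hyv⟩ := exists_ne_of_subshiftKer_eq_bot hker hv
    let Zv : Finset Γ := K ∪ K.image (v + ·)
    -- The pattern of `y` on K ∪ (v + K) witnesses that v is not a period; it is copied to a place
    -- disjoint from `Z`, so the earlier witnesses survive.
    obtain ⟨a, ha⟩ := Infinite.exists_notMem_finset (Z - Zv)
    have hout : ∀ q ∈ Zv, a + q ∉ Z := fun q hq h =>
      ha (Finset.mem_sub.2 ⟨_, h, q, hq, by abel⟩)
    let ζ' : Γ → A := fun q => if q ∈ Z then ζ q else y (q - a)
    have hin' : ∀ q ∈ Z, ζ' q = ζ q := fun q hq => if_pos hq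
    have hout' : ∀ q ∈ Zv, ζ' (a + q) = y q := fun q hq => by
      simp only [ζ', if_neg (hout q hq), add_sub_cancel_left]
    have hZ1 : ∀ w ∈ K, w ∈ Zv := fun w hw => Finset.mem_union_left _ hw
    have hZ2 : ∀ w ∈ K, v + w ∈ Zv := fun w hw =>
      Finset.mem_union_right _ (Finset.mem_image_of_mem _ hw)
    refine ⟨Z ∪ Zv.image (a + ·), ζ', fun v' hv' hne => ?_⟩
    rcases Finset.mem_insert.1 hv' with rfl | hv'
    · refine ⟨a, fun w hw => ⟨?_, ?_⟩, ?_, ?_, ?_⟩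
      · exact Finset.mem_union_right _ (Finset.mem_image_of_mem _ (hZ1 w hw))
      · rw [add_assoc]
        exact Finset.mem_union_right _ (Finset.mem_image_of_mem _ (hZ2 w hw))
      · have h1 := hout' 0 (hZ1 0 hK)
        have h2 := hout' _ (hZ2 0 hK)
        rw [add_zero] at h1 h2
        rwa [h1, h2]
      · refine ⟨shift (-a) y, Y.mapsTo _ hy, fun w hw => ?_⟩
        rw [hout' w (hZ1 w hw)]
        simp
      · refine ⟨shift (-a) y, Y.mapsTo _ hy, fun w hw => ?_⟩
        rw [add_assoc, hout' _ (hZ2 w hw)]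
        simp
    · obtain ⟨p, hp, hne', ⟨y₁, hy₁, h1⟩, y₂, hy₂, h2⟩ := hζ v' hv' hne
      have hp0 := hp 0 hK
      rw [add_zero, add_zero] at hp0
      refine ⟨p, fun w hw => ⟨Finset.mem_union_left _ (hp w hw).1,
        Finset.mem_union_left _ (hp w hw).2⟩, ?_, ⟨y₁, hy₁, fun w hw => ?_⟩,
        y₂, hy₂, fun w hw => ?_⟩
      · rwa [hin' _ hp0.1, hin' _ hp0.2]
      · rw [hin' _ (hp w hw).1, h1 w hw]
      · rw [hin' _ (hp w hw).2, h2 w hw]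

end LowerBound

/-! ### Points with prescribed stabilizer -/

section Exact

variable {Γ : Type*} [AddCommGroup Γ] {A : Type*}

theorem ncard_admissible_univ {G : Type*} [Fintype G] (X : Set (G → A)) :
    (admissible X Finset.univ).ncard = X.ncard :=
  Set.ncard_image_of_injective X fun _ _ h =>
    funext fun g => congrFun h ⟨g, Finset.mem_univ g⟩

theorem ncard_quotientImage_le_of_le [Finite A] {Γ₀ Γ₁ : AddSubgroup Γ} [Finite (Γ ⧸ Γ₁)]
    {S : Set (Γ → A)} (hS : ∀ x ∈ S, Γ₁ ≤ pointStab x) :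
    (quotientImage Γ₀ S).ncard ≤ (quotientImage Γ₁ S).ncard := by
  have hex : ∀ z ∈ quotientImage Γ₀ S, ∃ z' : Γ ⧸ Γ₁ → A, ∀ v : Γ, z v = z' v := by
    rintro z ⟨x, hx, hxz⟩
    obtain ⟨z', hz'⟩ := le_pointStab_iff_exists.1 (hS x hx)
    exact ⟨z', fun v => (hxz v).symm.trans (hz' v)⟩
  have : ∀ z : Γ ⧸ Γ₀ → A, ∃ z' : Γ ⧸ Γ₁ → A, z ∈ quotientImage Γ₀ S → ∀ v : Γ, z v = z' v := by
    intro z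
    by_cases hz : z ∈ quotientImage Γ₀ S
    · obtain ⟨z', hz'⟩ := hex z hz
      exact ⟨z', fun _ => hz'⟩
    · exact ⟨fun _ => z 0, fun h => absurd h hz⟩
  choose φ hφ using this
  refine Set.ncard_le_ncard_of_injOn φ ?_ ?_ (Set.toFinite _)
  · intro z hz
    have h := hφ z hz
    obtain ⟨x, hx, hxz⟩ := hz
    exact ⟨x, hx, fun v => (hxz v).trans (h v)⟩
  · intro z hz z' hz' h
    ext g
    obtain ⟨v, rfl⟩ := QuotientAddGroup.mk_surjective g
    rw [hφ z hz, hφ z' hz', h]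

variable [Finite A] [TopologicalSpace A] {Y : Subshift A Γ}

-- Shearer's inequality with the whole finite quotient as the large set: there is no boundary, so
-- the bound holds without error term.
open Pointwise in
theorem ncard_quotientImage_fixedPart_le [DecidableEq Γ] {Γ₁ : AddSubgroup Γ}
    [Finite (Γ ⧸ Γ₁)] {F : Finset Γ} (hF : F.Nonempty) (hΓ : AvoidsNonzero Γ₁ (F - F)) {b : ℝ}
    (hb : Real.log ((admissible Y.carrier F).ncard : ℝ) ≤ b * F.card) :
    ((quotientImage Γ₁ (fixedPart Y Γ₁)).ncard : ℝ) ≤ Real.exp (b * Γ₁.index) := by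
  classical
  have := Fintype.ofFinite (Γ ⧸ Γ₁)
  set X := quotientImage Γ₁ (fixedPart Y Γ₁) with hX
  rcases X.eq_empty_or_nonempty with h | hne
  · rw [h, Set.ncard_empty, Nat.cast_zero]
    positivity
  have hXpos : (0 : ℝ) < X.ncard := by exact_mod_cast (Set.ncard_pos (Set.toFinite X)).2 hne
  have hFc : (0 : ℝ) < F.card := by exact_mod_cast hF.card_pos
  have h1 := card_mul_log_ncard_admissible_le hne
    (mapsTo_shift_quotientImage Γ₁ (mapsTo_shift_fixedPart Y Γ₁))
    (F.image (QuotientAddGroup.mk : Γ → Γ ⧸ Γ₁)) Finset.univ (hF.image _)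
  rw [ncard_admissible_univ, Finset.card_image_of_injOn hΓ.injOn_mk] at h1
  have h2 : ((Finset.card (Finset.univ - F.image (QuotientAddGroup.mk : Γ → Γ ⧸ Γ₁)) : ℕ) : ℝ)
      ≤ Γ₁.index := by
    rw [AddSubgroup.index_eq_card, Nat.card_eq_fintype_card]
    exact_mod_cast Finset.card_le_univ _
  have h3 : Real.log (admissible X (F.image (QuotientAddGroup.mk : Γ → Γ ⧸ Γ₁))).ncard
      ≤ b * F.card := by
    refine (Real.log_le_log (by exact_mod_cast ncard_admissible_pos hne _) ?_).trans hb
    exact_mod_cast (ncard_admissible_quotientImage_le Γ₁ _ F).trans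
      (ncard_admissible_mono (Set.sep_subset _ _) F)
  have h4 : 0 ≤ Real.log (admissible X (F.image (QuotientAddGroup.mk : Γ → Γ ⧸ Γ₁))).ncard :=
    Real.log_natCast_nonneg _
  have h5 := mul_le_mul h2 h3 h4 (Nat.cast_nonneg _)
  rw [← Real.log_le_iff_le_exp hXpos]
  refine le_of_mul_le_mul_left ?_ hFc
  linarith

/-- Points of `Y_{[Γ₀]}` whose stabilizer is a small proper overgroup of `Γ₀` are few. -/
theorem ncard_diff_exactPart_le [DecidableEq Γ] {Γ₀ : AddSubgroup Γ} (hfin : Γ₀.FiniteIndex)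
    {V : Finset Γ} {b : ℝ} (hb0 : 0 ≤ b)
    (hb : ∀ Γ₁ : AddSubgroup Γ, Γ₁.FiniteIndex → AvoidsNonzero Γ₁ V →
      ((quotientImage Γ₁ (fixedPart Y Γ₁)).ncard : ℝ) ≤ Real.exp (b * Γ₁.index))
    {S : Set (Γ ⧸ Γ₀ → A)} (hS : S ⊆ quotientImage Γ₀ (fixedPart Y Γ₀))
    (hSV : ∀ z ∈ S, AvoidsNonzero (pointStab fun v : Γ => z v) V) :
    ((S \ quotientImage Γ₀ (exactPart Y Γ₀)).ncard : ℝ)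
      ≤ Γ₀.index * Real.exp (b * (Γ₀.index / 2)) := by
  classical
  have hfinq : Finite (Γ ⧸ Γ₀) := inferInstance
  have := Fintype.ofFinite (Γ ⧸ Γ₀)
  -- Every stabilizer strictly above Γ₀ contains one of these groups. There is at most one for each
  -- coset, and a proper overgroup has at most half the index. It is small because it lies in the
  -- stabilizer of a point of `S`.
  let Γg : Γ ⧸ Γ₀ → AddSubgroup Γ := fun g => Γ₀ ⊔ AddSubgroup.zmultiples g.out
  let I : Finset (Γ ⧸ Γ₀) := Finset.univ.filter fun g => g.out ∉ Γ₀ ∧ AvoidsNonzero (Γg g) V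
  have hcover : S \ quotientImage Γ₀ (exactPart Y Γ₀)
      ⊆ ⋃ g ∈ I, quotientImage Γ₀ (fixedPart Y (Γg g)) := by
    rintro z ⟨hzS, hz⟩
    have hfix := mem_quotientImage.1 (hS hzS)
    set x : Γ → A := fun v => z v with hx
    have hne : pointStab x ≠ Γ₀ := by
      intro h
      refine hz (mem_quotientImage.2 ?_)
      rw [exactPart, if_pos hfin]
      exact ⟨hfix.1, h⟩
    obtain ⟨v, hv, hvΓ⟩ : ∃ v ∈ pointStab x, v ∉ Γ₀ := by
      by_contra! h
      exact hne (le_antisymm h hfix.2)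
    set g : Γ ⧸ Γ₀ := QuotientAddGroup.mk v with hg
    have hgv : g.out - v ∈ Γ₀ := by
      rw [← QuotientAddGroup.eq_zero_iff, QuotientAddGroup.mk_sub, QuotientAddGroup.out_eq', hg,
        sub_self]
    have hgst : g.out ∈ pointStab x := by
      have := (pointStab x).add_mem (hfix.2 hgv) hv
      rwa [sub_add_cancel] at this
    have hle : Γg g ≤ pointStab x :=
      sup_le hfix.2 (AddSubgroup.zmultiples_le_of_mem hgst)
    refine Set.mem_biUnion (Finset.mem_filter.2 ⟨Finset.mem_univ g, fun h => hvΓ ?_, ?_⟩)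
      (mem_quotientImage.2 ⟨hfix.1, hle⟩)
    · have := Γ₀.sub_mem h hgv
      rwa [sub_sub_cancel] at this
    · exact fun w hw hwg => hSV z hzS w hw (hle hwg)
  have hpiece : ∀ g ∈ I, ((quotientImage Γ₀ (fixedPart Y (Γg g))).ncard : ℝ)
      ≤ Real.exp (b * (Γ₀.index / 2)) := by
    intro g hg
    obtain ⟨-, hgΓ, hgV⟩ := Finset.mem_filter.1 hg
    have hle : Γ₀ ≤ Γg g := le_sup_left
    have hfing : (Γg g).FiniteIndex := AddSubgroup.finiteIndex_of_le hle
    have hmul := AddSubgroup.relIndex_mul_index hle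
    have hrel1 : Γ₀.relIndex (Γg g) ≠ 1 := fun h => hgΓ (AddSubgroup.relIndex_eq_one.1 h
      ((le_sup_right : _ ≤ Γg g) (AddSubgroup.mem_zmultiples _)))
    have hrel0 : Γ₀.relIndex (Γg g) ≠ 0 := fun h => by
      rw [h, zero_mul] at hmul
      exact hfin.index_ne_zero hmul.symm
    have hidx : 2 * (Γg g).index ≤ Γ₀.index := by
      rw [← hmul]
      exact Nat.mul_le_mul_right _ (by omega)
    have hidx' : ((Γg g).index : ℝ) ≤ Γ₀.index / 2 := by
      rw [le_div_iff₀ two_pos, mul_comm]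
      exact_mod_cast hidx
    have hfinqg : Finite (Γ ⧸ Γg g) := inferInstance
    calc ((quotientImage Γ₀ (fixedPart Y (Γg g))).ncard : ℝ)
        ≤ (quotientImage (Γg g) (fixedPart Y (Γg g))).ncard := by
          exact_mod_cast ncard_quotientImage_le_of_le fun x (hx : x ∈ fixedPart Y (Γg g)) => hx.2
      _ ≤ Real.exp (b * (Γg g).index) := hb _ hfing hgV
      _ ≤ _ := Real.exp_le_exp.2 (mul_le_mul_of_nonneg_left hidx' hb0)
  calc ((S \ quotientImage Γ₀ (exactPart Y Γ₀)).ncard : ℝ)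
      ≤ (⋃ g ∈ I, quotientImage Γ₀ (fixedPart Y (Γg g))).ncard := by
        exact_mod_cast Set.ncard_le_ncard hcover (Set.toFinite _)
    _ ≤ ∑ g ∈ I, ((quotientImage Γ₀ (fixedPart Y (Γg g))).ncard : ℝ) := by
        exact_mod_cast Finset.set_ncard_biUnion_le I _
    _ ≤ I.card • Real.exp (b * (Γ₀.index / 2)) := Finset.sum_le_card_nsmul _ _ _ hpiece
    _ ≤ _ := by
        rw [nsmul_eq_mul, AddSubgroup.index_eq_card, Nat.card_eq_fintype_card]
        refine mul_le_mul_of_nonneg_right ?_ (Real.exp_pos _).le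
        exact_mod_cast Finset.card_le_univ I

open Pointwise in
theorem eventually_le_index [Infinite Γ] (N : ℕ) :
    ∀ᶠ Γ₀ in 𝓝 (⊥ : AddSubgroup Γ), Γ₀.FiniteIndex → N ≤ Γ₀.index := by
  classical
  obtain ⟨V, hV⟩ := Infinite.exists_subset_card_eq Γ N
  filter_upwards [eventually_avoidsNonzero (V - V)] with Γ₀ hΓ hfin
  have := Fintype.ofFinite (Γ ⧸ Γ₀)
  rw [← hV, ← Finset.card_image_of_injOn hΓ.injOn_mk, AddSubgroup.index_eq_card,
    Nat.card_eq_fintype_card]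
  exact Finset.card_le_univ _

open Pointwise in
/-- Many points of `Y_{[Γ₀]}` have no nonzero element of `V` as a period, for `Γ₀` small of finite
index. -/
theorem eventually_exists_many_with_broken_periods [DiscreteTopology A] [Countable Γ] [Infinite Γ]
    (hY : HasMapExtensionProperty Y) (hYne : Y.carrier.Nonempty) (hker : subshiftKer Y = ⊥)
    {h s : ℝ} (hs0 : 0 < s) (hs : s < h)
    (hh : ∀ F : Finset Γ, h * F.card ≤ Real.log ((admissible Y.carrier F).ncard : ℝ))
    (V : Finset Γ) :
    ∀ᶠ Γ₀ in 𝓝 (⊥ : AddSubgroup Γ), Γ₀.FiniteIndex →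
      ∃ S ⊆ quotientImage Γ₀ (fixedPart Y Γ₀),
        (∀ z ∈ S, AvoidsNonzero (pointStab fun v : Γ => z v) V) ∧
          Real.exp (s * Γ₀.index) ≤ S.ncard := by
  classical
  obtain ⟨K, V₁, hK, hglue⟩ := hY.exists_gluing hYne
  obtain ⟨Z, ζ, hζ⟩ := exists_period_breaking hYne hker K hK V
  have h0 : 0 < h := hs0.trans hs
  -- Chosen so that h(1 - 3ε) = s: 2ε is lost in the packing, and the last ε absorbs the cells of
  -- the pattern and the boundary around it once the index is at least `N`.
  set ε : ℝ := (h - s) / (3 * h) with hε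
  have hεpos : 0 < ε := div_pos (by linarith) (by linarith)
  have hεh : h * (1 - 3 * ε) = s := by rw [hε]; field_simp; ring
  obtain ⟨F, V₂, hcount⟩ :=
    exists_forall_le_log_ncard_agreeingPart hYne hK hglue h0.le hh hεpos
  obtain ⟨N, hN⟩ := exists_nat_ge ((Z.card + Z.card * F.card : ℝ) / ε)
  filter_upwards [eventually_avoidsNonzero V₂, eventually_avoidsNonzero (Z - Z),
    eventually_le_index N] with Γ₀ hΓ hΓZ hidx hfin
  have := Fintype.ofFinite (Γ ⧸ Γ₀)
  have hinj := hΓZ.injOn_mk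
  obtain ⟨z₀, hz₀⟩ : ∃ z₀ : Γ ⧸ Γ₀ → A, ∀ p ∈ Z, z₀ p = ζ p := by
    refine ⟨fun g => if hg : ∃ p ∈ Z, (p : Γ ⧸ Γ₀) = g then ζ hg.choose else hYne.some 0,
      fun p hp => ?_⟩
    have hg : ∃ p' ∈ Z, (p' : Γ ⧸ Γ₀) = p := ⟨p, hp, rfl⟩
    simp only [dif_pos hg]
    congr 1
    exact hinj hg.choose_spec.1 hp hg.choose_spec.2
  set Zq : Finset (Γ ⧸ Γ₀) := Z.image QuotientAddGroup.mk with hZq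
  -- Only the complement of the period-breaking pattern is packed, so the admissible places inside
  -- the pattern keep their letters.
  set E : Finset (Γ ⧸ Γ₀) := Finset.univ \ Zq with hE
  have hZE : ∀ p ∈ Z, (p : Γ ⧸ Γ₀) ∉ E := fun p hp h =>
    (Finset.mem_sdiff.1 h).2 (Finset.mem_image_of_mem _ hp)
  refine ⟨agreeingPart Y Γ₀ K E z₀, Set.sep_subset _ _, fun z hz v hv hvst => ?_, ?_⟩
  · by_contra hv0
    obtain ⟨p, hpZ, hne, ⟨y₁, hy₁, h1⟩, y₂, hy₂, h2⟩ := hζ v hv hv0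
    have hp0 := hpZ 0 hK
    rw [add_zero, add_zero] at hp0
    have e1 : z p = ζ p := by
      rw [hz.2 p (fun w hw => hZE _ (hpZ w hw).1), hz₀ _ hp0.1]
      exact ⟨y₁, hy₁, fun w hw => (h1 w hw).trans (hz₀ _ (hpZ w hw).1).symm⟩
    have e2 : z (p + v : Γ) = ζ (p + v) := by
      rw [hz.2 (p + v) (fun w hw => hZE _ (hpZ w hw).2), hz₀ _ hp0.2]
      exact ⟨y₂, hy₂, fun w hw => (h2 w hw).trans (hz₀ _ (hpZ w hw).2).symm⟩
    refine hne ?_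
    rw [← e1, ← e2, add_comm p v]
    exact mem_pointStab.1 hvst p
  · have h1 := hcount Γ₀ hΓ E z₀
    have hbd : ((folnerBoundary (F.image (QuotientAddGroup.mk : Γ → Γ ⧸ Γ₀)) E).ncard : ℝ)
        ≤ Z.card * F.card := by
      have hsub : folnerBoundary (F.image (QuotientAddGroup.mk : Γ → Γ ⧸ Γ₀)) E
          ⊆ ((Zq - F.image (QuotientAddGroup.mk : Γ → Γ ⧸ Γ₀) : Finset (Γ ⧸ Γ₀)) :
            Set (Γ ⧸ Γ₀)) := by
        rintro g ⟨-, k, hk, hkE⟩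
        have : g + k ∈ Zq := by simpa [hE] using hkE
        exact Finset.mem_coe.2 (Finset.mem_sub.2 ⟨_, this, k, hk, by abel⟩)
      have h2 := Set.ncard_le_ncard hsub (Finset.finite_toSet _)
      rw [Set.ncard_coe_finset] at h2
      exact_mod_cast h2.trans (Finset.card_sub_le.trans
        (Nat.mul_le_mul Finset.card_image_le Finset.card_image_le))
    have hEc : (Γ₀.index : ℝ) ≤ E.card + Z.card := by
      have h2 : Γ₀.index ≤ E.card + Zq.card := by
        rw [hE, AddSubgroup.index_eq_card, Nat.card_eq_fintype_card, ← Finset.card_univ]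
        exact Finset.card_le_card_sdiff_add_card
      exact_mod_cast h2.trans (Nat.add_le_add_left Finset.card_image_le _)
    have hEc' : (E.card : ℝ) ≤ Γ₀.index := by
      rw [AddSubgroup.index_eq_card, Nat.card_eq_fintype_card]
      exact_mod_cast Finset.card_le_univ E
    have hNi : (Z.card + Z.card * F.card : ℝ) ≤ ε * Γ₀.index := by
      have h2 : (N : ℝ) ≤ Γ₀.index := by exact_mod_cast hidx hfin
      have h3 := hN.trans h2
      rw [div_le_iff₀ hεpos] at h3
      linarith
    have hmain : (1 - 3 * ε) * Γ₀.index ≤ (1 - 2 * ε) * E.card -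
        (folnerBoundary (F.image (QuotientAddGroup.mk : Γ → Γ ⧸ Γ₀)) E).ncard := by
      have := mul_le_mul_of_nonneg_left hEc' hεpos.le
      linarith
    have h2 := (mul_le_mul_of_nonneg_left hmain h0.le).trans h1
    rw [← mul_assoc, hεh] at h2
    have hne : (agreeingPart Y Γ₀ K E z₀).Nonempty := by
      by_contra hem
      rw [Set.not_nonempty_iff_eq_empty.1 hem, admissible, Set.image_empty, Set.ncard_empty,
        Nat.cast_zero, Real.log_zero] at h2
      have h3 : (0 : ℝ) < Γ₀.index := by
        exact_mod_cast Nat.pos_of_ne_zero hfin.index_ne_zero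
      exact absurd h2 (not_le.2 (mul_pos hs0 h3))
    have h3 : (admissible (agreeingPart Y Γ₀ K E z₀) E).ncard ≤ (agreeingPart Y Γ₀ K E z₀).ncard :=
      Set.ncard_image_le (Set.toFinite _)
    rw [← Real.le_log_iff_exp_le (by exact_mod_cast (Set.ncard_pos (Set.toFinite _)).2 hne)]
    exact h2.trans (Real.log_le_log (by exact_mod_cast ncard_admissible_pos hne _)
      (by exact_mod_cast h3))

/-- Squaring 1 + δn/2 ≤ exp(δn/2) gives a term δ²n²/4, which is at least n once n ≥ 4/δ². -/
theorem exists_forall_natCast_add_one_le_exp {δ : ℝ} (hδ : 0 < δ) :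
    ∃ N : ℕ, ∀ n : ℕ, N ≤ n → (n : ℝ) + 1 ≤ Real.exp (δ * n) := by
  obtain ⟨N, hN⟩ := exists_nat_ge (4 / δ ^ 2)
  refine ⟨N, fun n hn => ?_⟩
  have h1 : 4 / δ ^ 2 ≤ n := hN.trans (by exact_mod_cast hn)
  rw [div_le_iff₀ (by positivity)] at h1
  have h2 : 1 + δ * n / 2 ≤ Real.exp (δ * n / 2) := by
    linarith [Real.add_one_le_exp (δ * n / 2)]
  have h3 : Real.exp (δ * n) = Real.exp (δ * n / 2) ^ 2 := by
    rw [← Real.exp_nat_mul]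
    congr 1
    push_cast
    ring
  have h4 := pow_le_pow_left₀ (by positivity) h2 2
  have h5 := mul_le_mul_of_nonneg_right h1 (Nat.cast_nonneg (α := ℝ) n)
  have h6 : 0 ≤ δ * n := by positivity
  rw [h3]
  refine le_trans ?_ h4
  linarith

open Pointwise in
theorem eventually_lt_entropy_exactPart [DiscreteTopology A] [Countable Γ] [Infinite Γ]
    (hY : HasMapExtensionProperty Y) (hker : subshiftKer Y = ⊥) {c : EReal}
    (hc : c < entropy Y.carrier) :
    ∀ᶠ Γ₀ in 𝓝 (⊥ : AddSubgroup Γ), c < entropy (quotientImage Γ₀ (exactPart Y Γ₀)) := by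
  classical
  rcases Y.carrier.eq_empty_or_nonempty with hem | hYne
  · simp [hem, entropy_empty] at hc
  obtain ⟨h, -, hent, hh⟩ := exists_entropy_eq hYne Y.mapsTo
  have hpos : 0 < h := by
    obtain ⟨K, V, hK, hglue⟩ := hY.exists_gluing hYne
    obtain ⟨v, hv⟩ := exists_ne (0 : Γ)
    obtain ⟨y, hy, hyv⟩ := exists_ne_of_subshiftKer_eq_bot hker hv
    have := entropy_pos_of_gluesAt hK (hglue ⊥ (avoidsNonzero_bot V)) hy hyv
    rwa [hent, EReal.coe_pos] at this
  have hc' := hc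
  rw [hent] at hc'
  obtain ⟨r₀, hcr₀, hr₀h⟩ := EReal.lt_iff_exists_real_btwn.1 hc'
  rw [EReal.coe_lt_coe_iff] at hr₀h
  -- Points with too many periods number at most n·exp((5/4)h·n/2). Since 5/8 < 3/4, this is at most
  -- n·exp(rn). Taking it away from exp(sn) points with s > r leaves at least exp(rn) for large n.
  set r : ℝ := max r₀ (3 / 4 * h) with hr
  have hcr : c < (r : EReal) := hcr₀.trans_le (EReal.coe_le_coe_iff.2 (le_max_left _ _))
  have hrh : r < h := max_lt hr₀h (by linarith)
  have hr34 : 3 / 4 * h ≤ r := le_max_right _ _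
  obtain ⟨s, hrs, hsh⟩ := exists_between hrh
  obtain ⟨F, hF, hFlt⟩ := exists_log_ncard_admissible_lt hYne (c := 5 / 4 * h) (by
    rw [hent, EReal.coe_lt_coe_iff]; linarith)
  obtain ⟨N, hN⟩ := exists_forall_natCast_add_one_le_exp (sub_pos.2 hrs)
  filter_upwards [eventually_lt_entropy_fixedPart hY hc, eventually_le_index N,
    eventually_exists_many_with_broken_periods hY hYne hker (by linarith) hsh hh (F - F)]
    with Γ₀ hfix hidx hmany
  by_cases hfin : Γ₀.FiniteIndex
  swap
  · rwa [exactPart, if_neg hfin]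
  obtain ⟨S, hS, hSV, hScard⟩ := hmany hfin
  have hfinq : Finite (Γ ⧸ Γ₀) := inferInstance
  have := Fintype.ofFinite (Γ ⧸ Γ₀)
  have hdiff := ncard_diff_exactPart_le hfin (V := F - F) (b := 5 / 4 * h) (by positivity)
    (fun Γ₁ hΓ₁ hV => by
      have : Finite (Γ ⧸ Γ₁) := inferInstance
      exact ncard_quotientImage_fixedPart_le hF hV hFlt.le) hS hSV
  set X := quotientImage Γ₀ (exactPart Y Γ₀) with hX
  set n := Γ₀.index with hn
  have hn0 : (0 : ℝ) < n := by exact_mod_cast Nat.pos_of_ne_zero hfin.index_ne_zero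
  have hSX : (S.ncard : ℝ) ≤ (S \ X).ncard + X.ncard := by
    exact_mod_cast (Set.ncard_le_ncard (Set.subset_sdiff_union S X) (Set.toFinite _)).trans
      (Set.ncard_union_le _ _)
  have hexp1 : Real.exp (5 / 4 * h * (n / 2)) ≤ Real.exp (r * n) :=
    Real.exp_le_exp.2 (by nlinarith)
  have hexp2 : ((n : ℝ) + 1) * Real.exp (r * n) ≤ Real.exp (s * n) := by
    have : Real.exp (s * n) = Real.exp ((s - r) * n) * Real.exp (r * n) := by
      rw [← Real.exp_add]
      congr 1
      ring
    rw [this]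
    exact mul_le_mul_of_nonneg_right (hN n (hidx hfin)) (Real.exp_pos _).le
  have hXcard : Real.exp (r * n) ≤ X.ncard := by
    have := mul_le_mul_of_nonneg_left hexp1 hn0.le
    linarith
  have hXpos : (0 : ℝ) < X.ncard := (Real.exp_pos _).trans_le hXcard
  have hXne : X.Nonempty := (Set.ncard_pos (Set.toFinite X)).1 (by exact_mod_cast hXpos)
  refine hcr.trans_le (le_entropy hXne ?_)
  filter_upwards [eventually_folnerFilter_eq_univ] with E hE
  rw [hE, ncard_admissible_univ, Finset.card_univ, ← Nat.card_eq_fintype_card,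
    ← AddSubgroup.index_eq_card, le_div_iff₀ hn0]
  exact (Real.le_log_iff_exp_le hXpos).2 hXcard

end Exact

/-! ### Assembly of the two limits -/

theorem mainTheorem8 {Γ : Type*} [AddCommGroup Γ] [Countable Γ]
    {A : Type*} [Finite A] [TopologicalSpace A] [DiscreteTopology A]
    (Y : Subshift A Γ) (hY : HasMapExtensionProperty Y) :
    Tendsto (fun Γ₀ : AddSubgroup Γ => entropy (quotientImage Γ₀ (fixedPart Y Γ₀)))
        (𝓝 ⊥) (𝓝 (entropy Y.carrier)) ∧
      (subshiftKer Y = ⊥ →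
        Tendsto (fun Γ₀ : AddSubgroup Γ => entropy (quotientImage Γ₀ (exactPart Y Γ₀)))
            (𝓝[≠] ⊥) (𝓝 (entropy Y.carrier)) ∧
          (Infinite Γ →
            Tendsto (fun Γ₀ : AddSubgroup Γ => entropy (quotientImage Γ₀ (exactPart Y Γ₀)))
              (𝓝 ⊥) (𝓝 (entropy Y.carrier)))) := by
  rcases finite_or_infinite Γ with hfin | hinf
  · have := Fintype.ofFinite Γ
    -- For finite Γ the trivial subgroup is isolated, so only its own quotient matters and the
    -- punctured limit is vacuous.
    have hbot : ∀ᶠ Γ₀ in 𝓝 (⊥ : AddSubgroup Γ), Γ₀ = ⊥ :=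
      (eventually_avoidsNonzero Finset.univ).mono fun Γ₀ hΓ =>
        (AddSubgroup.eq_bot_iff_forall Γ₀).2 fun v hv => hΓ v (Finset.mem_univ v) hv
    refine ⟨tendsto_order.2 ⟨fun c hc => ?_, fun c hc => eventually_entropy_fixedPart_lt Y hc⟩,
      fun _ => ⟨?_, fun hinf => absurd hfin (not_finite_iff_infinite.2 hinf)⟩⟩
    · filter_upwards [hbot] with Γ₀ hΓ
      rw [hΓ]
      exact hc.trans_le (entropy_le_entropy_quotientImage_bot Y)
    · have : (𝓝[≠] (⊥ : AddSubgroup Γ)) = ⊥ := by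
        rw [← Filter.eventually_false_iff_eq_bot, eventually_nhdsWithin_iff]
        exact hbot.mono fun Γ₀ h hne => hne h
      rw [this]
      exact tendsto_bot
  · have hexact : subshiftKer Y = ⊥ →
        Tendsto (fun Γ₀ : AddSubgroup Γ => entropy (quotientImage Γ₀ (exactPart Y Γ₀)))
          (𝓝 ⊥) (𝓝 (entropy Y.carrier)) := fun hker =>
      tendsto_order.2 ⟨fun c hc => eventually_lt_entropy_exactPart hY hker hc, fun c hc =>
        (eventually_entropy_fixedPart_lt Y hc).mono fun Γ₀ h =>
          (entropy_mono (quotientImage_mono Γ₀ (exactPart_subset_fixedPart Y Γ₀))).trans_lt h⟩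
    exact ⟨tendsto_order.2 ⟨fun c hc => eventually_lt_entropy_fixedPart hY hc,
      fun c hc => eventually_entropy_fixedPart_lt Y hc⟩,
      fun hker => ⟨(hexact hker).mono_left nhdsWithin_le_nhds, fun _ => hexact hker⟩⟩
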